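/- Throughout, $I=[0,1]$. For a real separable Hilbert space $K$ let $\mathcal{FS}(K)$ be the set of bounded selfadjoint Fredholm operators on $K$ with the norm topology. For a bounded selfadjoint operator $T$ let $\chi_{[a,b]}(T)$ be its spectral projection for the interval $[a,b]$, and let $E(T,[a,b])=\operatorname{im}\chi_{[a,b]}(T)$ be the spectral subspace, i.e. the largest closed $T$-invariant subspace on which $a\|u\|^2\le\langle Tu,u\rangle\le b\|u\|^2$. For a path $L=\{L_\lambda\}_{\lambda\in I}$ in $\mathcal{FS}(K)$, an admissible partition consists of $0=\lambda_0<\dots<\lambda_N=1$ and $a_1,\dots,a_N>0$ such that $\lambda\mapsto\chi_{[-a_i,a_i]}(L_\lambda)$ is, on each $[\lambda_{i-1},\lambda_i]$, a norm-continuous family of finite rank projections. The spectral flow is $$\operatorname{sf}(L)=\sum_{i=1}^N\big(\dim E(L_{\lambda_i},[0,a_i])-\dim E(L_{\lambda_{i-1}},[0,a_i])\big)\in\mathbb{Z}.$$ If a group $G$ acts orthogonally on $K$ and each $L_\lambda$ is $G$-equivariant, i.e. $L_\lambda(gu)=g(L_\lambda u)$, the spaces $E(L_\lambda,[0,a_i])$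 occurring here are finite dimensional real representations of $G$, and the equivariant spectral flow is $$\operatorname{sf}_G(L)=\sum_{i=1}^N\big([E(L_{\lambda_i},[0,a_i])]-[E(L_{\lambda_{i-1}},[0,a_i])]\big)\in RO(G),$$ where $RO(G)$ is the Grothendieck group of the monoid (under direct sum) of isomorphism classes of finite dimensional real representations of $G$. **Lemma 6.1 ($\mathbb{Z}_2$ spectral flow formula).** Let $H$ be a real separable Hilbert space on which $G=\mathbb{Z}_2$ acts orthogonally, with fixed point space $H^G$, and let $L=\{L_\lambda\}_{\lambda\in I}$ be a path in $\mathcal{FS}(H)$ of $G$-equivariant operators. The homomorphism $$\phi:RO(\mathbb{Z}_2)\to\mathbb{Z}\oplus\mathbb{Z},\qquad \phi([E]-[F])=(\dim E-\dim F,\ \dim E^G-\dim F^G),$$ is bijective. The restrictions $L|_{H^G}$ and $L|_{(H^G)^\perp}$ are paths in $\mathcal{FS}(H^G)$ and $\mathcal{FS}((H^G)^\perp)$. The spectral flows $\operatorname{sf}_G(L)$, $\operatorname{sf}(L)$, $\operatorname{sf}(L|_{H^G})$ and $\operatorname{sf}(L|_{(H^G)^\perp})$ are well defined, i.e. admissible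 partitions exist and the sums above do not depend on the choice of the admissible partition. Moreover, $$\phi(\operatorname{sf}_G(L))=(\operatorname{sf}(L),\ \operatorname{sf}(L|_{H^G})),\qquad \operatorname{sf}(L)=\operatorname{sf}(L|_{H^G})+\operatorname{sf}(L|_{(H^G)^\perp}).$$ -/

import Mathlib

universe u v

/-! ### Spectral subspaces and spectral projections -/

section Spectral

variable {H : Type*} [NormedAddCommGroup H] [InnerProductSpace ℝ H]

/-- The spectral subspace `E(T, [a, b])`, that is the image of the spectral projection
`χ_[a,b](T)`, of a bounded selfadjoint operator `T` on a real Hilbert space: the largest closed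
`T`-invariant subspace on which `a ≤ T ≤ b` in the sense of quadratic forms, equivalently on which
the spectrum of `T` lies in `[a, b]`.  (When it is finite dimensional it is the direct sum of the
eigenspaces of `T` for the eigenvalues in `[a, b]`.) -/
noncomputable def spectralSubspace (T : H →L[ℝ] H) (a b : ℝ) : Submodule ℝ H :=
  (sSup {M : Submodule ℝ H | (∀ x ∈ M, T x ∈ M) ∧
    ∀ x ∈ M, a * ‖x‖ ^ 2 ≤ inner ℝ (T x) x ∧ inner ℝ (T x) x ≤ b * ‖x‖ ^ 2}).topologicalClosure

theorem spectralSubspace_mono (T : H →L[ℝ] H) {a b a' b' : ℝ} (ha : a' ≤ a) (hb : b ≤ b') :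
    spectralSubspace T a b ≤ spectralSubspace T a' b' := by
  refine Submodule.topologicalClosure_mono (sSup_le_sSup ?_)
  rintro M ⟨h1, h2⟩
  refine ⟨h1, fun x hx => ⟨?_, ?_⟩⟩
  · exact (mul_le_mul_of_nonneg_right ha (sq_nonneg _)).trans (h2 x hx).1
  · exact (h2 x hx).2.trans (mul_le_mul_of_nonneg_right hb (sq_nonneg _))

/-- The spectral projection `χ_[a,b](T)`: the orthogonal projection onto `E(T, [a, b])`. -/
noncomputable def spectralProjection [CompleteSpace H] (T : H →L[ℝ] H) (a b : ℝ) : H →L[ℝ] H :=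
  haveI : CompleteSpace (spectralSubspace T a b) :=
    (Submodule.isClosed_topologicalClosure _).completeSpace_coe
  (spectralSubspace T a b).starProjection

/-- The set `FS(H)` of bounded selfadjoint Fredholm operators. -/
def IsSelfAdjointFredholm [CompleteSpace H] (T : H →L[ℝ] H) : Prop :=
  IsSelfAdjoint T ∧ T.IsFredholm

/-- `L` is a path in `FS(H)`, which carries the norm topology. -/
def IsFSPath [CompleteSpace H] (L : unitInterval → H →L[ℝ] H) : Prop :=
  Continuous L ∧ ∀ t, IsSelfAdjointFredholm (L t)

end Spectral

/-! ### The spectral flow -/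

section SpectralFlow

variable {H : Type*} [NormedAddCommGroup H] [InnerProductSpace ℝ H] [CompleteSpace H]

/-- The data entering the definition of the spectral flow of a path `L`: a partition
`0 = t₀ < ⋯ < t_N = 1` of the unit interval and numbers `a₁, …, a_N > 0` (here indexed by
`Fin N`) such that `t ↦ χ_[-aᵢ,aᵢ](L t)` is, on `[tᵢ₋₁, tᵢ]`, a norm continuous family of
projections of finite rank. -/
structure SpectralPartition (L : unitInterval → H →L[ℝ] H) where
  N : ℕ
  node : Fin (N + 1) → unitInterval
  node_strictMono : StrictMono node
  node_zero : node 0 = 0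
  node_last : node (Fin.last N) = 1
  a : Fin N → ℝ
  a_pos : ∀ i, 0 < a i
  finiteRank : ∀ i, ∀ t ∈ Set.Icc (node i.castSucc) (node i.succ),
    FiniteDimensional ℝ (spectralSubspace (L t) (-a i) (a i))
  continuousOn : ∀ i, ContinuousOn (fun t => spectralProjection (L t) (-a i) (a i))
    (Set.Icc (node i.castSucc) (node i.succ))

namespace SpectralPartition

variable {L : unitInterval → H →L[ℝ] H} (p : SpectralPartition L)

theorem finite_succ (i : Fin p.N) :
    FiniteDimensional ℝ (spectralSubspace (L (p.node i.succ)) 0 (p.a i)) := by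
  have := p.finiteRank i (p.node i.succ)
    ⟨p.node_strictMono.monotone i.castSucc_lt_succ.le, le_rfl⟩
  exact Submodule.finiteDimensional_of_le
    (spectralSubspace_mono _ (neg_nonpos.2 (p.a_pos i).le) le_rfl)

theorem finite_castSucc (i : Fin p.N) :
    FiniteDimensional ℝ (spectralSubspace (L (p.node i.castSucc)) 0 (p.a i)) := by
  have := p.finiteRank i (p.node i.castSucc)
    ⟨le_rfl, p.node_strictMono.monotone i.castSucc_lt_succ.le⟩
  exact Submodule.finiteDimensional_of_le
    (spectralSubspace_mono _ (neg_nonpos.2 (p.a_pos i).le) le_rfl)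

/-- The sum `∑ᵢ (dim E(L_{tᵢ}, [0, aᵢ]) - dim E(L_{tᵢ₋₁}, [0, aᵢ]))`. -/
noncomputable def flow : ℤ :=
  ∑ i : Fin p.N,
    ((Module.finrank ℝ (spectralSubspace (L (p.node i.succ)) 0 (p.a i)) : ℤ) -
      (Module.finrank ℝ (spectralSubspace (L (p.node i.castSucc)) 0 (p.a i)) : ℤ))

end SpectralPartition

/-- The spectral flow of `L` is well defined and equal to `n`: there are admissible partitions,
and each of them gives the value `n`. -/
def HasSpectralFlow (L : unitInterval → H →L[ℝ] H) (n : ℤ) : Prop :=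
  Nonempty (SpectralPartition L) ∧ ∀ p : SpectralPartition L, p.flow = n

open Classical in
/-- The spectral flow `sfl(L) ∈ ℤ` (with the value `0` if it is not well defined). -/
noncomputable def sfl (L : unitInterval → H →L[ℝ] H) : ℤ :=
  if h : ∃ n, HasSpectralFlow L n then h.choose else 0

end SpectralFlow

/-! ### The representation group `RO(G)` -/

section RO

/-- A finite dimensional real representation of the group `G` (finite, or considered as a
discrete group, so that there is no continuity condition). -/
structure RealRep (G : Type v) [Group G] where
  V : Type u
  [addCommGroup : AddCommGroup V]
  [module : Module ℝ V]
  [finite : FiniteDimensional ℝ V]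
  rep : Representation ℝ G V

attribute [instance] RealRep.addCommGroup RealRep.module RealRep.finite

variable {G : Type v} [Group G]

/-- Isomorphism of representations. -/
instance RealRep.setoid : Setoid (RealRep.{u} G) where
  r X Y := Nonempty (X.rep.Equiv Y.rep)
  iseqv := ⟨fun X => ⟨.refl X.rep⟩, fun ⟨e⟩ => ⟨e.symm⟩, fun ⟨e⟩ ⟨f⟩ => ⟨e.trans f⟩⟩

/-- The direct sum of two representations. -/
noncomputable def RealRep.sum (X Y : RealRep.{u} G) : RealRep.{u} G where
  V := X.V × Y.V
  rep := X.rep.prod Y.rep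

variable (G) in
/-- Isomorphism classes of finite dimensional real representations of `G`. -/
def RepClass : Type (max (u + 1) v) := Quotient (RealRep.setoid.{u} (G := G))

noncomputable instance RepClass.instAdd : Add (RepClass.{u} G) where
  add := Quotient.map₂ RealRep.sum (by
    rintro X X' ⟨e⟩ Y Y' ⟨f⟩
    refine ⟨.mk (e.toLinearEquiv.prodCongr f.toLinearEquiv) fun g => LinearMap.ext fun x => ?_⟩
    exact Prod.ext (e.toIntertwiningMap.isIntertwining' g |> LinearMap.congr_fun <| x.1)
      (f.toIntertwiningMap.isIntertwining' g |> LinearMap.congr_fun <| x.2))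

noncomputable instance RepClass.instZero : Zero (RepClass.{u} G) where
  zero := Quotient.mk _ ⟨PUnit.{u + 1}, Representation.trivial ℝ G PUnit.{u + 1}⟩

/-- The isomorphism classes form a commutative monoid under the direct sum. -/
noncomputable instance RepClass.addCommMonoid : AddCommMonoid (RepClass.{u} G) where
  add_assoc := by
    rintro ⟨X⟩ ⟨Y⟩ ⟨Z⟩
    exact Quotient.sound ⟨.mk (LinearEquiv.prodAssoc ℝ X.V Y.V Z.V) (fun g => rfl)⟩
  zero_add := by
    rintro ⟨X⟩
    exact Quotient.sound
      ⟨.mk (LinearEquiv.uniqueProd : (PUnit.{u + 1} × X.V) ≃ₗ[ℝ] X.V) (fun g => rfl)⟩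
  add_zero := by
    rintro ⟨X⟩
    exact Quotient.sound
      ⟨.mk (LinearEquiv.prodUnique : (X.V × PUnit.{u + 1}) ≃ₗ[ℝ] X.V) (fun g => rfl)⟩
  add_comm := by
    rintro ⟨X⟩ ⟨Y⟩
    exact Quotient.sound ⟨.mk (LinearEquiv.prodComm ℝ X.V Y.V) (fun g => rfl)⟩
  nsmul := nsmulRec

variable (G) in
/-- The Grothendieck group `RO(G)` of formal differences of isomorphism classes. -/
abbrev RO : Type (max (u + 1) v) := Algebra.GrothendieckAddGroup (RepClass.{u} G)

/-- The class `[X] ∈ RO(G)` of a representation. -/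
noncomputable def RealRep.toRO (X : RealRep.{u} G) : RO.{u} G :=
  Algebra.GrothendieckAddGroup.of (Quotient.mk _ X : RepClass.{u} G)

/-- The pair `(dim V, dim V^G)` of a representation `V`. -/
noncomputable def RealRep.dims (X : RealRep.{u} G) : ℤ × ℤ :=
  (Module.finrank ℝ X.V, Module.finrank ℝ X.rep.invariants)

theorem RealRep.dims_congr (X Y : RealRep.{u} G) (h : X ≈ Y) : X.dims = Y.dims := by
  obtain ⟨e⟩ := h
  have h2 : Y.rep.invariants = X.rep.invariants.map (e.toLinearEquiv : X.V →ₗ[ℝ] Y.V) := by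
    ext y
    simp only [Representation.mem_invariants, Submodule.mem_map]
    constructor
    · intro hy
      exact ⟨e.symm y, fun g => by
        have := LinearMap.congr_fun (e.symm.toIntertwiningMap.isIntertwining' g) y
        simpa [hy g] using this.symm, e.toLinearEquiv.apply_symm_apply y⟩
    · rintro ⟨x, hx, rfl⟩ g
      have := LinearMap.congr_fun (e.toIntertwiningMap.isIntertwining' g) x
      simp only [LinearMap.comp_apply, hx g] at this
      exact this.symm
  have h3 := LinearEquiv.finrank_map_eq e.toLinearEquiv X.rep.invariants
  unfold RealRep.dims
  rw [h2, h3, e.toLinearEquiv.finrank_eq]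

theorem RealRep.dims_sum (X Y : RealRep.{u} G) : (X.sum Y).dims = X.dims + Y.dims := by
  have h : (X.sum Y).rep.invariants = X.rep.invariants.prod Y.rep.invariants := by
    ext x
    exact ⟨fun hx => ⟨fun g => congrArg Prod.fst (hx g), fun g => congrArg Prod.snd (hx g)⟩,
      fun hx g => Prod.ext (hx.1 g) (hx.2 g)⟩
  let e : (X.rep.invariants.prod Y.rep.invariants) ≃ₗ[ℝ] X.rep.invariants × Y.rep.invariants :=
    { toFun := fun x => (⟨x.1.1, x.2.1⟩, ⟨x.1.2, x.2.2⟩)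
      invFun := fun x => ⟨(x.1.1, x.2.1), x.1.2, x.2.2⟩
      map_add' := fun _ _ => rfl
      map_smul' := fun _ _ => rfl
      left_inv := fun _ => rfl
      right_inv := fun _ => rfl }
  have h2 := e.finrank_eq
  have h3 : Module.finrank ℝ (X.sum Y).V = Module.finrank ℝ X.V + Module.finrank ℝ Y.V :=
    Module.finrank_prod
  unfold RealRep.dims
  rw [h, h3]
  refine Prod.ext (by simp) ?_
  simp only [Prod.snd_add]
  rw [← Nat.cast_add, ← Module.finrank_prod]
  exact congrArg _ h2

/-- The homomorphism `φ : RO(G) → ℤ ⊕ ℤ`,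
`φ([E] - [F]) = (dim E - dim F, dim E^G - dim F^G)`. -/
noncomputable def RO.phi : RO.{u} G →+ ℤ × ℤ :=
  Algebra.GrothendieckAddGroup.lift
    { toFun := Quotient.lift RealRep.dims RealRep.dims_congr
      map_zero' := by
        refine Prod.ext ?_ ?_
        · exact congrArg Nat.cast (Module.finrank_zero_of_subsingleton (R := ℝ) (M := PUnit.{u + 1}))
        · exact congrArg Nat.cast (Module.finrank_zero_of_subsingleton (R := ℝ)
            (M := (Representation.trivial ℝ G PUnit.{u + 1}).invariants))
      map_add' := by
        rintro ⟨X⟩ ⟨Y⟩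
        exact RealRep.dims_sum X Y }

end RO

/-! ### The equivariant spectral flow -/

section Equivariant

variable {G : Type v} [Group G] {H : Type u} [NormedAddCommGroup H] [InnerProductSpace ℝ H]

/-- The representation underlying an orthogonal action. -/
noncomputable def orthRep (ρ : G →* (H ≃ₗᵢ[ℝ] H)) : Representation ℝ G H where
  toFun g := (ρ g).toLinearEquiv.toLinearMap
  map_one' := by ext; simp
  map_mul' g h := by ext; simp

/-- `T(gu) = g(Tu)` for all `g ∈ G` and `u ∈ H`. -/
def IsEquivariant (ρ : G →* (H ≃ₗᵢ[ℝ] H)) (T : H →L[ℝ] H) : Prop :=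
  ∀ g u, T (ρ g u) = ρ g (T u)

/-- The fixed point space `H^G`. -/
noncomputable def fixedSpace (ρ : G →* (H ≃ₗᵢ[ℝ] H)) : Submodule ℝ H := (orthRep ρ).invariants

theorem mem_fixedSpace (ρ : G →* (H ≃ₗᵢ[ℝ] H)) (x : H) : x ∈ fixedSpace ρ ↔ ∀ g, ρ g x = x :=
  Iff.rfl

instance [CompleteSpace H] (ρ : G →* (H ≃ₗᵢ[ℝ] H)) : CompleteSpace (fixedSpace ρ) := by
  suffices IsClosed (fixedSpace ρ : Set H) from this.completeSpace_coe
  have : (fixedSpace ρ : Set H) = ⋂ g, {x | ρ g x = x} := by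
    ext x
    simp [mem_fixedSpace]
  rw [this]
  exact isClosed_iInter fun g => isClosed_eq (ρ g).continuous continuous_id

/-- An equivariant operator maps `H^G` into itself. -/
theorem IsEquivariant.map_fixed {ρ : G →* (H ≃ₗᵢ[ℝ] H)} {T : H →L[ℝ] H} (hT : IsEquivariant ρ T) :
    ∀ x ∈ fixedSpace ρ, T x ∈ fixedSpace ρ := fun x hx g => by
  have := hT g x
  rw [(mem_fixedSpace ρ x).1 hx g] at this
  exact this.symm

/-- A selfadjoint equivariant operator maps `(H^G)^⊥` into itself. -/
theorem IsEquivariant.map_fixed_orthogonal [CompleteSpace H] {ρ : G →* (H ≃ₗᵢ[ℝ] H)}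
    {T : H →L[ℝ] H} (hT : IsEquivariant ρ T) (hs : IsSelfAdjoint T) :
    ∀ x ∈ (fixedSpace ρ)ᗮ, T x ∈ (fixedSpace ρ)ᗮ := fun x hx y hy => by
  exact (hs.isSymmetric y x).symm.trans (hx _ (hT.map_fixed y hy))

/-- For an equivariant operator the spaces `E(T, [a, b])` are `G`-invariant. -/
theorem IsEquivariant.spectralSubspace_le {ρ : G →* (H ≃ₗᵢ[ℝ] H)} {T : H →L[ℝ] H}
    (hT : IsEquivariant ρ T) (a b : ℝ) (g : G) :
    spectralSubspace T a b ≤ (spectralSubspace T a b).comap (orthRep ρ g) := by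
  intro x hx
  have hcont : Continuous (orthRep ρ g) := (ρ g).continuous
  refine map_mem_closure hcont hx fun y hy => ?_
  have key : ∀ S : Submodule ℝ H, (∀ M : Submodule ℝ H, ((∀ x ∈ M, T x ∈ M) ∧ ∀ x ∈ M,
      a * ‖x‖ ^ 2 ≤ inner ℝ (T x) x ∧ inner ℝ (T x) x ≤ b * ‖x‖ ^ 2) → M ≤ S) →
      sSup {M : Submodule ℝ H | (∀ x ∈ M, T x ∈ M) ∧ ∀ x ∈ M,
      a * ‖x‖ ^ 2 ≤ inner ℝ (T x) x ∧ inner ℝ (T x) x ≤ b * ‖x‖ ^ 2} ≤ S :=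
    fun S hS => sSup_le hS
  refine key (Submodule.comap (orthRep ρ g) (sSup _)) (fun M hM => ?_) hy
  rw [← Submodule.map_le_iff_le_comap]
  refine le_sSup ⟨?_, ?_⟩
  · rintro _ ⟨z, hz, rfl⟩
    exact ⟨T z, hM.1 z hz, (hT g z).symm⟩
  · rintro _ ⟨z, hz, rfl⟩
    have h1 : inner ℝ (T (ρ g z)) (ρ g z) = inner ℝ (T z) z := by
      rw [hT g z, LinearIsometryEquiv.inner_map_map]
    have h2 : ‖ρ g z‖ = ‖z‖ := (ρ g).norm_map z
    have := hM.2 z hz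
    rw [← h1, ← h2] at this
    exact this

/-- The finite dimensional space `E(T, [a, b])` as a representation of `G`. -/
noncomputable def spectralRep (ρ : G →* (H ≃ₗᵢ[ℝ] H)) (T : H →L[ℝ] H) (hT : IsEquivariant ρ T)
    (a b : ℝ) (hfin : FiniteDimensional ℝ (spectralSubspace T a b)) : RealRep.{u} G where
  V := spectralSubspace T a b
  finite := hfin
  rep := (orthRep ρ).subrepresentation (spectralSubspace T a b) (hT.spectralSubspace_le a b)

variable [CompleteSpace H]

/-- The sum `∑ᵢ ([E(L_{tᵢ}, [0, aᵢ])] - [E(L_{tᵢ₋₁}, [0, aᵢ])]) ∈ RO(G)`. -/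
noncomputable def SpectralPartition.flowG {L : unitInterval → H →L[ℝ] H} (p : SpectralPartition L)
    (ρ : G →* (H ≃ₗᵢ[ℝ] H)) (hL : ∀ t, IsEquivariant ρ (L t)) : RO.{u} G :=
  ∑ i : Fin p.N,
    ((spectralRep ρ (L (p.node i.succ)) (hL _) 0 (p.a i) (p.finite_succ i)).toRO -
      (spectralRep ρ (L (p.node i.castSucc)) (hL _) 0 (p.a i) (p.finite_castSucc i)).toRO)

/-- The equivariant spectral flow of `L` is well defined and equal to `x`: there are admissible
partitions, and each of them gives the value `x`. -/
def HasEquivariantSpectralFlow (ρ : G →* (H ≃ₗᵢ[ℝ] H)) (L : unitInterval → H →L[ℝ] H)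
    (hL : ∀ t, IsEquivariant ρ (L t)) (x : RO.{u} G) : Prop :=
  Nonempty (SpectralPartition L) ∧ ∀ p : SpectralPartition L, p.flowG ρ hL = x

open Classical in
/-- The equivariant spectral flow `sfl_G(L) ∈ RO(G)` (with the value `0` if it is not well
defined). -/
noncomputable def sflG (ρ : G →* (H ≃ₗᵢ[ℝ] H)) (L : unitInterval → H →L[ℝ] H)
    (hL : ∀ t, IsEquivariant ρ (L t)) : RO.{u} G :=
  if h : ∃ x, HasEquivariantSpectralFlow ρ L hL x then h.choose else 0

end Equivariant

section Restriction

variable {H : Type*} [NormedAddCommGroup H] [InnerProductSpace ℝ H]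

/-- The path `L|_M` of restrictions of the operators `L t` to an invariant subspace `M`. -/
def restrictPath (L : unitInterval → H →L[ℝ] H) (M : Submodule ℝ H)
    (hM : ∀ t, ∀ x ∈ M, L t x ∈ M) : unitInterval → M →L[ℝ] M :=
  fun t => (L t).restrict (hM t)

end Restriction

/-! Everything is expressed through eigenvectors. A selfadjoint Fredholm operator is bounded below
by some c > 0 on the complement of a finite dimensional subspace. Hence, for 0 ≤ a < c, its spectral
subspace for [-a, a] is finite dimensional and spanned by eigenvectors, and on the orthogonal
complement the operator is bounded below by some b > a (`exists_gap`, a minimization argument used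
in place of the spectral theorem). Such a gap survives small perturbations and makes the spectral
projection Lipschitz in the operator (`norm_starProjection_sub_le`), so a Lebesgue number yields
admissible partitions.

For independence, let two cutoffs b ≤ a be admissible on the same interval. Then dim E([0, a]) - dim
E([0, b]) counts the eigenvalues in (b, a] with multiplicity. Neither this count nor the one in [-a,
-b) can drop under a small perturbation, while their sum is a difference of ranks of continuous
projections and so locally constant. Hence both are constant (`finrank_spectralSubspace_sub_eq`),
even if ±a or ±b are eigenvalues. Two partitions are then compared on all pairwise intersections of
their intervals.

An equivariant selfadjoint operator commutes with the projection onto H^G. Its finite dimensional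
spectral subspaces therefore split along H^G and the complement, and the part in H^G is the fixed
space of the spectral representation. This gives both formulas for each single partition.
Representations of ℤ₂ are determined by dim V and dim V^G, so φ is bijective; its injectivity
transfers independence of the partition from ℤ to RO(ℤ₂). -/

/-! ### Spans of eigenvectors and finite dimensional spectral subspaces -/

section EigenSpan

variable {H : Type*} [NormedAddCommGroup H] [InnerProductSpace ℝ H]

/-- The span of the eigenvectors of `T` for eigenvalues in `A`. -/
def eigenSpan (T : H →L[ℝ] H) (A : Set ℝ) : Submodule ℝ H :=
  ⨆ μ : A, Module.End.eigenspace (T : H →ₗ[ℝ] H) μ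

variable {T : H →L[ℝ] H} {A B : Set ℝ}

theorem eigenspace_le_eigenSpan {μ : ℝ} (hμ : μ ∈ A) :
    Module.End.eigenspace (T : H →ₗ[ℝ] H) μ ≤ eigenSpan T A :=
  le_iSup (fun μ : A => Module.End.eigenspace (T : H →ₗ[ℝ] H) μ) ⟨μ, hμ⟩

theorem mem_eigenSpan_of_apply_eq {μ : ℝ} (hμ : μ ∈ A) {x : H} (hx : T x = μ • x) :
    x ∈ eigenSpan T A :=
  eigenspace_le_eigenSpan hμ (Module.End.mem_eigenspace_iff.2 hx)

theorem eigenSpan_le {S : Submodule ℝ H} (h : ∀ μ ∈ A, ∀ x, T x = μ • x → x ∈ S) :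
    eigenSpan T A ≤ S :=
  iSup_le fun μ x hx => h μ μ.2 x (Module.End.mem_eigenspace_iff.1 hx)

theorem eigenSpan_mono (h : A ⊆ B) : eigenSpan T A ≤ eigenSpan T B :=
  eigenSpan_le fun _ hμ _ hx => mem_eigenSpan_of_apply_eq (h hμ) hx

theorem eigenSpan_union : eigenSpan T (A ∪ B) = eigenSpan T A ⊔ eigenSpan T B := by
  refine le_antisymm (eigenSpan_le ?_) (sup_le (eigenSpan_mono Set.subset_union_left)
    (eigenSpan_mono Set.subset_union_right))
  rintro μ (h | h) x hx
  · exact Submodule.mem_sup_left (mem_eigenSpan_of_apply_eq h hx)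
  · exact Submodule.mem_sup_right (mem_eigenSpan_of_apply_eq h hx)

theorem apply_mem_eigenSpan {x : H} (hx : x ∈ eigenSpan T A) : T x ∈ eigenSpan T A := by
  have : eigenSpan T A ≤ (eigenSpan T A).comap (T : H →ₗ[ℝ] H) := by
    refine eigenSpan_le fun μ hμ x hx => ?_
    simp only [Submodule.mem_comap, ContinuousLinearMap.coe_coe, hx]
    exact Submodule.smul_mem _ _ (mem_eigenSpan_of_apply_eq hμ hx)
  exact this hx

theorem eigenSpan_neg : eigenSpan (-T) A = eigenSpan T (-A) := by
  refine le_antisymm (eigenSpan_le fun μ hμ x hx => ?_) (eigenSpan_le fun μ hμ x hx => ?_)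
  · refine mem_eigenSpan_of_apply_eq (μ := -μ) (by simpa using hμ) ?_
    rw [neg_smul, ← hx]; simp
  · refine mem_eigenSpan_of_apply_eq (μ := -μ) hμ ?_
    rw [neg_smul, ← hx]; simp

/-- Every element of `eigenSpan T A` is a finite sum of eigenvectors. -/
theorem exists_sum_of_mem_eigenSpan {x : H} (hx : x ∈ eigenSpan T A) :
    ∃ (s : Finset A) (y : A → H), (∀ μ, T (y μ) = (μ : ℝ) • y μ) ∧ x = ∑ μ ∈ s, y μ := by
  obtain ⟨f, hf, rfl⟩ := (Submodule.mem_iSup_iff_exists_finsupp _ _).1 hx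
  exact ⟨f.support, f, fun μ => Module.End.mem_eigenspace_iff.1 (hf μ), rfl⟩

theorem inner_eigenvectors_eq_zero (hT : (T : H →ₗ[ℝ] H).IsSymmetric) {μ ν : ℝ} (h : μ ≠ ν)
    {x y : H} (hx : T x = μ • x) (hy : T y = ν • y) : inner ℝ x y = 0 := by
  have h1 : inner ℝ (T x) y = inner ℝ x (T y) := hT x y
  rw [hx, hy, real_inner_smul_left, real_inner_smul_right] at h1
  have h2 : (μ - ν) * inner ℝ x y = 0 := by linarith
  exact (mul_eq_zero.1 h2).resolve_left (sub_ne_zero.2 h)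

theorem inner_sum_eigenvectors (hT : (T : H →ₗ[ℝ] H).IsSymmetric) (s : Finset A) (y z : A → H)
    (hy : ∀ μ, T (y μ) = (μ : ℝ) • y μ) (hz : ∀ μ, T (z μ) = (μ : ℝ) • z μ) :
    inner ℝ (∑ μ ∈ s, y μ) (∑ μ ∈ s, z μ) = ∑ μ ∈ s, inner ℝ (y μ) (z μ) := by
  rw [sum_inner]
  refine Finset.sum_congr rfl fun μ hμ => ?_
  rw [inner_sum]
  refine Finset.sum_eq_single μ (fun ν _ hν => ?_) (fun h => absurd hμ h)
  exact inner_eigenvectors_eq_zero hT (fun h => hν (Subtype.ext h.symm)) (hy μ) (hz ν)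

theorem inner_apply_le_of_mem_eigenSpan (hT : (T : H →ₗ[ℝ] H).IsSymmetric) {b : ℝ}
    (hA : ∀ μ ∈ A, μ ≤ b) {x : H} (hx : x ∈ eigenSpan T A) : inner ℝ (T x) x ≤ b * ‖x‖ ^ 2 := by
  obtain ⟨s, y, hy, rfl⟩ := exists_sum_of_mem_eigenSpan hx
  rw [map_sum, ← real_inner_self_eq_norm_sq, inner_sum_eigenvectors hT s y y hy hy,
    inner_sum_eigenvectors hT s (fun μ => T (y μ)) y (fun μ => by rw [hy, map_smul, hy]) hy,
    Finset.mul_sum]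
  refine Finset.sum_le_sum fun μ _ => ?_
  rw [hy, real_inner_smul_left]
  exact mul_le_mul_of_nonneg_right (hA μ μ.2) real_inner_self_nonneg

theorem le_inner_apply_of_mem_eigenSpan (hT : (T : H →ₗ[ℝ] H).IsSymmetric) {a : ℝ}
    (hA : ∀ μ ∈ A, a ≤ μ) {x : H} (hx : x ∈ eigenSpan T A) : a * ‖x‖ ^ 2 ≤ inner ℝ (T x) x := by
  obtain ⟨s, y, hy, rfl⟩ := exists_sum_of_mem_eigenSpan hx
  rw [map_sum, ← real_inner_self_eq_norm_sq, inner_sum_eigenvectors hT s y y hy hy,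
    inner_sum_eigenvectors hT s (fun μ => T (y μ)) y (fun μ => by rw [hy, map_smul, hy]) hy,
    Finset.mul_sum]
  refine Finset.sum_le_sum fun μ _ => ?_
  rw [hy, real_inner_smul_left]
  exact mul_le_mul_of_nonneg_right (hA μ μ.2) real_inner_self_nonneg

/-- If the quadratic form of the symmetric operator `T` is bounded by `a` on an invariant
subspace, then so is its norm. -/
theorem norm_apply_le_of_abs_inner_le (hT : (T : H →ₗ[ℝ] H).IsSymmetric) {M : Submodule ℝ H}
    (hM : ∀ x ∈ M, T x ∈ M) {a : ℝ}
    (h : ∀ x ∈ M, -a * ‖x‖ ^ 2 ≤ inner ℝ (T x) x ∧ inner ℝ (T x) x ≤ a * ‖x‖ ^ 2) {x : H}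
    (hx : x ∈ M) : ‖T x‖ ≤ a * ‖x‖ := by
  by_cases hTx : T x = 0
  · by_cases hx0 : x = 0
    · simp [hx0]
    · have := (h x hx).2
      rw [hTx, inner_zero_left] at this
      have hp : 0 < ‖x‖ ^ 2 := by positivity
      have ha : 0 ≤ a := nonneg_of_mul_nonneg_left this hp
      rw [hTx, norm_zero]; positivity
  have hx0 : x ≠ 0 := fun h0 => hTx (by simp [h0])
  have hnx : 0 < ‖x‖ := norm_pos_iff.2 hx0
  have hnT : 0 < ‖T x‖ := norm_pos_iff.2 hTx
  -- Polarization: u and w have equal norm, and the form at u + w minus the form at u - w is 4⟨T u,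
  -- w⟩. The parallelogram law turns the two form bounds into the norm bound.
  set u := ‖T x‖ • x
  set w := ‖x‖ • T x
  have hu : u ∈ M := M.smul_mem _ hx
  have hw : w ∈ M := M.smul_mem _ (hM x hx)
  have h1 := (h _ (M.add_mem hu hw)).2
  have h2 := (h _ (M.sub_mem hu hw)).1
  have hs : inner ℝ (T w) u = inner ℝ (T u) w := by
    have := hT w u
    simp only [ContinuousLinearMap.coe_coe] at this
    rw [this, real_inner_comm]
  simp only [map_add, map_sub, inner_add_left, inner_add_right, inner_sub_left, inner_sub_right,
    hs] at h1 h2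
  have h3 : ‖u + w‖ ^ 2 + ‖u - w‖ ^ 2 = 4 * (‖T x‖ * ‖x‖) ^ 2 := by
    have := parallelogram_law_with_norm ℝ u w
    have e1 : ‖u‖ = ‖T x‖ * ‖x‖ := by simp [u, norm_smul]
    have e2 : ‖w‖ = ‖T x‖ * ‖x‖ := by simp [w, norm_smul, mul_comm]
    rw [e1, e2] at this
    linarith
  have h4 : inner ℝ (T u) w = ‖T x‖ ^ 3 * ‖x‖ := by
    simp only [u, w, map_smul, real_inner_smul_left, real_inner_smul_right,
      real_inner_self_eq_norm_sq]
    ring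
  have h5 : 4 * (‖T x‖ ^ 3 * ‖x‖) ≤ a * (4 * (‖T x‖ * ‖x‖) ^ 2) := by
    rw [← h3, ← h4]; linarith
  have h6 : (‖T x‖ ^ 2 * ‖x‖) * ‖T x‖ ≤ (‖T x‖ ^ 2 * ‖x‖) * (a * ‖x‖) := by nlinarith
  exact le_of_mul_le_mul_left h6 (by positivity)

theorem norm_apply_le_of_mem_eigenSpan (hT : (T : H →ₗ[ℝ] H).IsSymmetric) {a : ℝ}
    (hA : A ⊆ Set.Icc (-a) a) {x : H} (hx : x ∈ eigenSpan T A) : ‖T x‖ ≤ a * ‖x‖ :=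
  norm_apply_le_of_abs_inner_le hT (fun _ => apply_mem_eigenSpan) (fun _ hy =>
    ⟨le_inner_apply_of_mem_eigenSpan hT (fun _ hμ => (hA hμ).1) hy,
      inner_apply_le_of_mem_eigenSpan hT (fun _ hμ => (hA hμ).2) hy⟩) hx

theorem eigenSpan_isOrtho (hT : (T : H →ₗ[ℝ] H).IsSymmetric) (h : Disjoint A B) :
    eigenSpan T A ⟂ eigenSpan T B := by
  refine eigenSpan_le fun μ hμ x hx => ?_
  rw [Submodule.mem_orthogonal']
  intro y hy
  have : eigenSpan T B ≤ (ℝ ∙ x)ᗮ := eigenSpan_le fun ν hν z hz => by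
    rw [Submodule.mem_orthogonal_singleton_iff_inner_right]
    exact inner_eigenvectors_eq_zero hT (Set.disjoint_iff_forall_ne.1 h hμ hν) hx hz
  exact Submodule.mem_orthogonal_singleton_iff_inner_right.1 (this hy)

theorem eigenSpan_inf_orthogonal (hT : (T : H →ₗ[ℝ] H).IsSymmetric) (h : A ⊆ B) :
    eigenSpan T B ⊓ (eigenSpan T A)ᗮ = eigenSpan T (B \ A) := by
  refine le_antisymm ?_ (le_inf (eigenSpan_mono Set.sdiff_subset)
    (eigenSpan_isOrtho hT Set.disjoint_sdiff_left))
  rintro x ⟨hx, hx'⟩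
  rw [SetLike.mem_coe, ← Set.union_sdiff_cancel h, eigenSpan_union] at hx
  obtain ⟨y, hy, z, hz, rfl⟩ := Submodule.mem_sup.1 hx
  have h1 : inner ℝ y (y + z) = 0 := (Submodule.mem_orthogonal _ _).1 hx' y hy
  have h2 : inner ℝ y z = 0 :=
    (eigenSpan_isOrtho hT Set.disjoint_sdiff_right).inner_eq hy hz
  rw [inner_add_right, h2, add_zero, inner_self_eq_zero] at h1
  simpa [h1] using hz

theorem finrank_eigenSpan_union (hT : (T : H →ₗ[ℝ] H).IsSymmetric) (h : Disjoint A B)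
    [FiniteDimensional ℝ (eigenSpan T A)] [FiniteDimensional ℝ (eigenSpan T B)] :
    Module.finrank ℝ (eigenSpan T (A ∪ B)) =
      Module.finrank ℝ (eigenSpan T A) + Module.finrank ℝ (eigenSpan T B) := by
  rw [eigenSpan_union, ← Submodule.finrank_sup_add_finrank_inf_eq,
    (eigenSpan_isOrtho hT h).disjoint.eq_bot, finrank_bot, add_zero]

/-- The finite dimensional spectral theorem diagonalizes T on M, and the Rayleigh quotient of each
eigenvector places its eigenvalue in [a, b]. -/
theorem le_eigenSpan_of_finiteDimensional (hT : (T : H →ₗ[ℝ] H).IsSymmetric) {a b : ℝ}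
    {M : Submodule ℝ H} [FiniteDimensional ℝ M] (hM : ∀ x ∈ M, T x ∈ M)
    (h : ∀ x ∈ M, a * ‖x‖ ^ 2 ≤ inner ℝ (T x) x ∧ inner ℝ (T x) x ≤ b * ‖x‖ ^ 2) :
    M ≤ eigenSpan T (Set.Icc a b) := by
  have hS := hT.restrict_invariant hM
  have htop : (⨆ μ, Module.End.eigenspace ((T : H →ₗ[ℝ] H).restrict hM) μ) = ⊤ :=
    Submodule.orthogonal_eq_bot_iff.1 hS.orthogonalComplement_iSup_eigenspaces_eq_bot
  have hle : (⨆ μ, Module.End.eigenspace ((T : H →ₗ[ℝ] H).restrict hM) μ) ≤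
      (eigenSpan T (Set.Icc a b)).comap M.subtype := by
    refine iSup_le fun μ x hx => ?_
    have hx' : T x = μ • (x : H) := congrArg Subtype.val (Module.End.mem_eigenspace_iff.1 hx)
    by_cases hx0 : (x : H) = 0
    · simp [hx0]
    refine mem_eigenSpan_of_apply_eq ?_ hx'
    have hpos : 0 < ‖(x : H)‖ ^ 2 := by positivity
    have := h x x.2
    rw [hx', real_inner_smul_left, real_inner_self_eq_norm_sq] at this
    exact ⟨le_of_mul_le_mul_right this.1 hpos, le_of_mul_le_mul_right this.2 hpos⟩
  rw [htop] at hle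
  exact fun x hx => hle (x := ⟨x, hx⟩) trivial

theorem le_spectralSubspace {a b : ℝ} {M : Submodule ℝ H} (hM : ∀ x ∈ M, T x ∈ M)
    (h : ∀ x ∈ M, a * ‖x‖ ^ 2 ≤ inner ℝ (T x) x ∧ inner ℝ (T x) x ≤ b * ‖x‖ ^ 2) :
    M ≤ spectralSubspace T a b := by
  refine le_trans ?_ (Submodule.le_topologicalClosure _)
  exact le_sSup ⟨hM, h⟩

theorem eigenSpan_le_spectralSubspace (hT : (T : H →ₗ[ℝ] H).IsSymmetric) (a b : ℝ) :
    eigenSpan T (Set.Icc a b) ≤ spectralSubspace T a b :=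
  le_spectralSubspace (fun _ => apply_mem_eigenSpan) fun _ hx =>
    ⟨le_inner_apply_of_mem_eigenSpan hT (fun _ hμ => hμ.1) hx,
      inner_apply_le_of_mem_eigenSpan hT (fun _ hμ => hμ.2) hx⟩

/-- Each subspace in the defining supremum lies in the span of eigenvectors once it is known to be
finite dimensional. That span is closed, being finite dimensional, so the topological closure adds
nothing. -/
theorem spectralSubspace_eq_eigenSpan_of_forall (hT : (T : H →ₗ[ℝ] H).IsSymmetric) {a b : ℝ}
    [FiniteDimensional ℝ (eigenSpan T (Set.Icc a b))]
    (h : ∀ M : Submodule ℝ H, (∀ x ∈ M, T x ∈ M) →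
      (∀ x ∈ M, a * ‖x‖ ^ 2 ≤ inner ℝ (T x) x ∧ inner ℝ (T x) x ≤ b * ‖x‖ ^ 2) →
      FiniteDimensional ℝ M) :
    spectralSubspace T a b = eigenSpan T (Set.Icc a b) := by
  refine le_antisymm ?_ (eigenSpan_le_spectralSubspace hT a b)
  refine Submodule.topologicalClosure_minimal _ (sSup_le ?_)
    (Submodule.closed_of_finiteDimensional _)
  rintro M ⟨h1, h2⟩
  have := h M h1 h2
  exact le_eigenSpan_of_finiteDimensional hT h1 h2

/-- A finite dimensional spectral subspace is spanned by eigenvectors. -/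
theorem spectralSubspace_eq_eigenSpan (hT : (T : H →ₗ[ℝ] H).IsSymmetric) {a b : ℝ}
    (hfin : FiniteDimensional ℝ (spectralSubspace T a b)) :
    spectralSubspace T a b = eigenSpan T (Set.Icc a b) := by
  have := Submodule.finiteDimensional_of_le (eigenSpan_le_spectralSubspace hT a b)
  refine spectralSubspace_eq_eigenSpan_of_forall hT fun M h1 h2 => ?_
  exact Submodule.finiteDimensional_of_le (le_spectralSubspace h1 h2)

end EigenSpan

/-! ### Spectral gap below the essential spectrum -/

section Gap

variable {H : Type*} [NormedAddCommGroup H] [InnerProductSpace ℝ H] {T : H →L[ℝ] H}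

theorem apply_mem_orthogonal (hT : (T : H →ₗ[ℝ] H).IsSymmetric) {M : Submodule ℝ H}
    (hM : ∀ x ∈ M, T x ∈ M) : ∀ x ∈ Mᗮ, T x ∈ Mᗮ := fun x hx y hy => by
  exact (hT y x).symm.trans (hx _ (hM y hy))

/-- A minimizer of `‖T x‖ / ‖x‖` on an invariant subspace is an eigenvector of `T ^ 2`. -/
theorem apply_apply_eq_of_forall_le (hT : (T : H →ₗ[ℝ] H).IsSymmetric) {K : Submodule ℝ H}
    (hK : ∀ x ∈ K, T x ∈ K) {r : ℝ} (hr : ∀ x ∈ K, r ^ 2 * ‖x‖ ^ 2 ≤ ‖T x‖ ^ 2) {x : H}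
    (hx : x ∈ K) (hxr : ‖T x‖ ^ 2 = r ^ 2 * ‖x‖ ^ 2) : T (T x) = r ^ 2 • x := by
  set w := T (T x) - r ^ 2 • x with hw
  have hwK : w ∈ K := K.sub_mem (hK _ (hK _ hx)) (K.smul_mem _ hx)
  have h1 : inner ℝ (T x) (T w) - r ^ 2 * inner ℝ x w = ‖w‖ ^ 2 := by
    have : inner ℝ (T x) (T w) = inner ℝ (T (T x)) w := (hT (T x) w).symm
    rw [this, ← real_inner_smul_left, ← inner_sub_left, real_inner_self_eq_norm_sq]
  -- First variation in the direction w: ‖T(x + s w)‖² - r²‖x + s w‖² is a nonnegative quadratic in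
  -- s without constant term, so its linear coefficient 2‖w‖² must vanish.
  have h2 : ∀ s : ℝ, 0 ≤ (‖T w‖ ^ 2 - r ^ 2 * ‖w‖ ^ 2) * (s * s) + (2 * ‖w‖ ^ 2) * s + 0 := by
    intro s
    have h3 := hr _ (K.add_mem hx (K.smul_mem s hwK))
    rw [map_add, map_smul, norm_add_sq_real, norm_add_sq_real, norm_smul, norm_smul,
      real_inner_smul_right, real_inner_smul_right, mul_pow, mul_pow, Real.norm_eq_abs,
      sq_abs] at h3
    have := congrArg (fun t => 2 * s * t) h1
    nlinarith
  have h3 := discrim_le_zero h2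
  have h4 : (2 * ‖w‖ ^ 2) ^ 2 ≤ 0 := by simpa [discrim] using h3
  have h5 : ‖w‖ = 0 := by
    have := pow_eq_zero_iff (two_ne_zero) |>.1 (le_antisymm h4 (sq_nonneg _))
    simpa using this
  exact sub_eq_zero.1 (norm_eq_zero.1 h5)

/-- The component of z in Nᗮ is stretched by at least c > r, so if z is stretched by little more
than r and has a small component in N, then z itself is small. Applied to differences of a
minimizing sequence, this replaces compactness. -/
theorem norm_sub_le_of_almost_minimizing {N : Submodule ℝ H} [N.HasOrthogonalProjection]
    {c r η : ℝ} (hc : ∀ x ∈ Nᗮ, c * ‖x‖ ≤ ‖T x‖) (hr0 : 0 ≤ r) (hrc : r < c)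
    {z : H} (hz : ‖T z‖ ≤ η + r * ‖z‖) (hN : ‖N.starProjection z‖ ≤ η) :
    ‖z‖ ≤ (1 + (r + ‖T‖ + 1) / (c - r)) * η := by
  set p := N.starProjection z
  set w := z - p with hw
  have hwN : w ∈ Nᗮ := Submodule.sub_starProjection_mem_orthogonal z
  have hzw : z = p + w := by simp [hw]
  have h1 := hc w hwN
  have h2 : ‖T w‖ ≤ ‖T z‖ + ‖T‖ * ‖p‖ := by
    rw [hw, map_sub]
    exact (norm_sub_le _ _).trans (add_le_add_right (T.le_opNorm p) _)
  have h3 : ‖z‖ ≤ ‖p‖ + ‖w‖ := by rw [hzw]; exact norm_add_le _ _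
  have hcr : 0 < c - r := sub_pos.2 hrc
  have h4 : (c - r) * ‖w‖ ≤ (r + ‖T‖ + 1) * η := by
    have e1 := mul_le_mul_of_nonneg_left h3 hr0
    have e2 := mul_le_mul_of_nonneg_left hN (norm_nonneg T)
    have e3 := mul_le_mul_of_nonneg_left hN hr0
    nlinarith
  have h5 : ‖w‖ ≤ (r + ‖T‖ + 1) * η / (c - r) := by
    rw [le_div_iff₀ hcr]; linarith
  calc ‖z‖ ≤ η + (r + ‖T‖ + 1) * η / (c - r) := by linarith
    _ = _ := by ring

open Filter Topology in
/-- If `T` is bounded below by `c` on the complement of a finite dimensional subspace, then the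
infimum `r < c` of `‖T x‖ / ‖x‖` on a closed invariant subspace is attained. -/
theorem exists_eigenvector_of_tendsto [CompleteSpace H] (hT : (T : H →ₗ[ℝ] H).IsSymmetric)
    {N : Submodule ℝ H} [FiniteDimensional ℝ N] {c r : ℝ} (hc : ∀ x ∈ Nᗮ, c * ‖x‖ ≤ ‖T x‖)
    (hr0 : 0 ≤ r) (hrc : r < c) {K : Submodule ℝ H} (hKc : IsClosed (K : Set H))
    (hK : ∀ x ∈ K, T x ∈ K) (hr : ∀ x ∈ K, r * ‖x‖ ≤ ‖T x‖) {x : ℕ → H} (hxK : ∀ n, x n ∈ K)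
    (hx1 : ∀ n, ‖x n‖ = 1) (hxr : Tendsto (fun n => ‖T (x n)‖) atTop (𝓝 r)) :
    ∃ y ∈ K, ‖y‖ = 1 ∧ T (T y) = r ^ 2 • y := by
  have hr' : ∀ y ∈ K, r ^ 2 * ‖y‖ ^ 2 ≤ ‖T y‖ ^ 2 := fun y hy => by
    rw [← mul_pow]; exact pow_le_pow_left₀ (by positivity) (hr y hy) 2
  -- Only the components in the finite dimensional N converge by compactness; the rest of the
  -- subsequence is controlled by almost minimality.
  obtain ⟨l, -, φ, hφ, hl⟩ := tendsto_subseq_of_bounded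
    (s := Metric.closedBall (0 : N) 1) Metric.isBounded_closedBall
    (x := fun n => N.orthogonalProjectionOnto (x n)) (fun n => by
      rw [mem_closedBall_zero_iff]
      exact (N.norm_orthogonalProjectionOnto_apply_le _).trans (hx1 n).le)
  have hu : CauchySeq (fun n => N.starProjection (x (φ n))) :=
    ((N.subtypeL.continuous.tendsto l).comp hl).cauchySeq
  have hq : Tendsto (fun n => ‖T (x (φ n))‖ ^ 2 - r ^ 2) atTop (𝓝 0) := by
    have := ((hxr.comp hφ.tendsto_atTop).pow 2).sub_const (r ^ 2)
    simpa using this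
  have hcauchy : CauchySeq (fun n => x (φ n)) := by
    rw [Metric.cauchySeq_iff]
    intro ε hε
    set C := 1 + (r + ‖T‖ + 1) / (c - r) with hC
    have hCpos : 0 < C := by
      have : 0 < c - r := sub_pos.2 hrc
      positivity
    obtain ⟨η, hη, hηε⟩ : ∃ η > 0, C * η < ε := ⟨ε / (2 * C), by positivity, by
      field_simp; linarith⟩
    obtain ⟨n₁, h₁⟩ := Metric.cauchySeq_iff.1 hu η hη
    obtain ⟨n₂, h₂⟩ := Filter.eventually_atTop.1
      (hq.eventually_lt_const (show 0 < η ^ 2 / 4 by positivity))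
    refine ⟨max n₁ n₂, fun m hm n hn => ?_⟩
    rw [dist_eq_norm]
    refine lt_of_le_of_lt (norm_sub_le_of_almost_minimizing hc hr0 hrc ?_ ?_) hηε
    -- Parallelogram law for the vectors and for their images: since the sum of two terms is
    -- stretched by at least r, the difference is stretched by hardly more than r.
    · have e1 := h₂ m ((le_max_right _ _).trans hm)
      have e2 := h₂ n ((le_max_right _ _).trans hn)
      have p1 := parallelogram_law_with_norm ℝ (T (x (φ m))) (T (x (φ n)))
      have p2 := parallelogram_law_with_norm ℝ (x (φ m)) (x (φ n))
      rw [hx1, hx1] at p2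
      have e3 := hr' _ (K.add_mem (hxK (φ m)) (hxK (φ n)))
      rw [map_add] at e3
      rw [map_sub]
      have e4 : ‖T (x (φ m)) - T (x (φ n))‖ ^ 2 ≤ η ^ 2 + r ^ 2 * ‖x (φ m) - x (φ n)‖ ^ 2 := by
        have := congrArg (fun t => r ^ 2 * t) p2
        nlinarith
      refine (sq_le_sq₀ (norm_nonneg _) (by positivity)).1 (e4.trans ?_)
      have : 0 ≤ η * (r * ‖x (φ m) - x (φ n)‖) := by positivity
      nlinarith
    · have := h₁ m ((le_max_left _ _).trans hm) n ((le_max_left _ _).trans hn)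
      rw [dist_eq_norm, ← map_sub] at this
      exact this.le
  obtain ⟨y, hy⟩ := cauchySeq_tendsto_of_complete hcauchy
  have hyK : y ∈ K := hKc.mem_of_tendsto hy (Eventually.of_forall fun n => hxK _)
  have hy1 : ‖y‖ = 1 := tendsto_nhds_unique hy.norm (by simp [hx1])
  have hyr : ‖T y‖ = r := tendsto_nhds_unique ((T.continuous.tendsto y).comp hy).norm
    (hxr.comp hφ.tendsto_atTop)
  exact ⟨y, hyK, hy1, apply_apply_eq_of_forall_le hT hK hr' hyK (by rw [hyr, hy1]; ring)⟩

open Filter Topology in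
/-- Below the essential spectrum, the operator has a spectral gap. -/
theorem exists_gap [CompleteSpace H] (hT : (T : H →ₗ[ℝ] H).IsSymmetric)
    {N : Submodule ℝ H} [FiniteDimensional ℝ N] {c a : ℝ} (hc : ∀ x ∈ Nᗮ, c * ‖x‖ ≤ ‖T x‖)
    (ha0 : 0 ≤ a) (hac : a < c) :
    ∃ b > a, ∀ x ∈ (eigenSpan T (Set.Icc (-a) a))ᗮ, b * ‖x‖ ≤ ‖T x‖ := by
  -- Without a gap, the infimum r of ‖T x‖ on the unit sphere of K is at most a < c, hence attained,
  -- which produces an eigenvector in K that K excludes.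
  by_contra! hcon
  set K := (eigenSpan T (Set.Icc (-a) a))ᗮ with hKdef
  have hK : ∀ x ∈ K, T x ∈ K := apply_mem_orthogonal hT fun _ => apply_mem_eigenSpan
  set R : Set ℝ := {t | ∃ x ∈ K, ‖x‖ = 1 ∧ ‖T x‖ = t}
  have hRb : BddBelow R := ⟨0, by rintro _ ⟨x, -, -, rfl⟩; exact norm_nonneg _⟩
  have hR : ∀ b > a, ∃ t ∈ R, t < b := fun b hb => by
    obtain ⟨x, hx, hxb⟩ := hcon b hb
    have hx0 : x ≠ 0 := by rintro rfl; simp at hxb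
    have hpos : 0 < ‖x‖ := norm_pos_iff.2 hx0
    refine ⟨_, ⟨‖x‖⁻¹ • x, K.smul_mem _ hx, ?_, rfl⟩, ?_⟩
    · rw [norm_smul, norm_inv, norm_norm, inv_mul_cancel₀ hpos.ne']
    · rw [map_smul, norm_smul, norm_inv, norm_norm, inv_mul_lt_iff₀ hpos]
      linarith
  have hRne : R.Nonempty := let ⟨t, ht, _⟩ := hR (a + 1) (by linarith); ⟨t, ht⟩
  set r := sInf R
  have hr0 : 0 ≤ r := le_csInf hRne (by rintro _ ⟨x, -, -, rfl⟩; exact norm_nonneg _)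
  have hra : r ≤ a := le_of_forall_gt_imp_ge_of_dense fun b hb => by
    obtain ⟨t, ht, htb⟩ := hR b hb
    exact (csInf_le hRb ht).trans htb.le
  have hr : ∀ x ∈ K, r * ‖x‖ ≤ ‖T x‖ := fun x hx => by
    by_cases hx0 : x = 0
    · simp [hx0]
    have hpos : 0 < ‖x‖ := norm_pos_iff.2 hx0
    have : r ≤ ‖x‖⁻¹ * ‖T x‖ := csInf_le hRb ⟨‖x‖⁻¹ • x, K.smul_mem _ hx, by
      rw [norm_smul, norm_inv, norm_norm, inv_mul_cancel₀ hpos.ne'], by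
      rw [map_smul, norm_smul, norm_inv, norm_norm]⟩
    rwa [le_inv_mul_iff₀ hpos, mul_comm] at this
  obtain ⟨t, -, ht, htR⟩ := exists_seq_tendsto_sInf hRne hRb
  choose x hxK hx1 hxt using htR
  obtain ⟨y, hyK, hy1, hy⟩ := exists_eigenvector_of_tendsto hT hc hr0 (hra.trans_lt hac)
    (Submodule.isClosed_orthogonal _) hK hr hxK hx1 (by simpa only [hxt] using ht)
  have hdisj : ∀ z ∈ K, ∀ μ ∈ Set.Icc (-a) a, T z = μ • z → z = 0 := fun z hz μ hμ h =>
    inner_self_eq_zero.1 ((Submodule.mem_orthogonal _ _).1 hz z (mem_eigenSpan_of_apply_eq hμ h))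
  -- Factor T² - r² = (T - r)(T + r): either T y + r y is an eigenvector for r, or y is one for -r.
  -- Both values lie in [-a, a], and K contains no such eigenvector.
  have h1 : T y + r • y = 0 := by
    refine hdisj _ (K.add_mem (hK _ hyK) (K.smul_mem _ hyK)) r ⟨by linarith, hra⟩ ?_
    rw [map_add, hy, map_smul, smul_add, smul_smul, sq, add_comm]
  have h2 : y = 0 := hdisj y hyK (-r) ⟨by linarith, by linarith⟩ (by
    rw [neg_smul]; exact eq_neg_of_add_eq_zero_left h1)
  simp [h2] at hy1

theorem disjoint_orthogonal_of_norm_le {N M : Submodule ℝ H} {c a : ℝ}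
    (hc : ∀ x ∈ Nᗮ, c * ‖x‖ ≤ ‖T x‖) (hac : a < c) (hM : ∀ x ∈ M, ‖T x‖ ≤ a * ‖x‖) :
    Disjoint M Nᗮ := by
  rw [Submodule.disjoint_def]
  intro x hx hx'
  by_contra h0
  have hpos : 0 < ‖x‖ := norm_pos_iff.2 h0
  exact absurd ((hc x hx').trans (hM x hx)) (not_le.2 (mul_lt_mul_of_pos_right hac hpos))

theorem injective_orthogonalProjection_of_disjoint {N M : Submodule ℝ H}
    [N.HasOrthogonalProjection] (h : Disjoint M Nᗮ) :
    Function.Injective ((N.orthogonalProjectionOnto : H →ₗ[ℝ] N).domRestrict M) := by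
  rw [injective_iff_map_eq_zero]
  intro x hx
  exact Subtype.ext (Submodule.disjoint_def.1 h x x.2
    (Submodule.orthogonalProjectionOnto_eq_zero_iff.1 hx))

theorem finiteDimensional_of_disjoint_orthogonal {N M : Submodule ℝ H} [FiniteDimensional ℝ N]
    (h : Disjoint M Nᗮ) : FiniteDimensional ℝ M :=
  FiniteDimensional.of_injective _ (injective_orthogonalProjection_of_disjoint h)

theorem finrank_le_of_disjoint_orthogonal {N M : Submodule ℝ H} [FiniteDimensional ℝ N]
    (h : Disjoint M Nᗮ) : Module.finrank ℝ M ≤ Module.finrank ℝ N :=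
  LinearMap.finrank_le_finrank_of_injective (injective_orthogonalProjection_of_disjoint h)

theorem finiteDimensional_eigenSpan (hT : (T : H →ₗ[ℝ] H).IsSymmetric)
    {N : Submodule ℝ H} [FiniteDimensional ℝ N] {c a : ℝ} (hc : ∀ x ∈ Nᗮ, c * ‖x‖ ≤ ‖T x‖)
    (hac : a < c) : FiniteDimensional ℝ (eigenSpan T (Set.Icc (-a) a)) :=
  finiteDimensional_of_disjoint_orthogonal (disjoint_orthogonal_of_norm_le hc hac
    fun _ => norm_apply_le_of_mem_eigenSpan hT subset_rfl)

theorem spectralSubspace_eq_eigenSpan_of_lt (hT : (T : H →ₗ[ℝ] H).IsSymmetric)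
    {N : Submodule ℝ H} [FiniteDimensional ℝ N] {c a : ℝ} (hc : ∀ x ∈ Nᗮ, c * ‖x‖ ≤ ‖T x‖)
    (hac : a < c) : spectralSubspace T (-a) a = eigenSpan T (Set.Icc (-a) a) := by
  have := finiteDimensional_eigenSpan hT hc hac
  exact spectralSubspace_eq_eigenSpan_of_forall hT fun M h1 h2 =>
    finiteDimensional_of_disjoint_orthogonal (disjoint_orthogonal_of_norm_le hc hac
      fun _ => norm_apply_le_of_abs_inner_le hT h1 h2)

end Gap

/-! ### Perturbation of spectral projections and existence of admissible partitions -/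

section LocalGap

variable {H : Type*} [NormedAddCommGroup H] [InnerProductSpace ℝ H] [CompleteSpace H]
  {T T' : H →L[ℝ] H}

open scoped LinearMap.FiniteRangeSetoid in
/-- A Fredholm operator is bounded below on the complement of a finite dimensional subspace. -/
theorem exists_bounded_below_of_isFredholm (hT : T.IsFredholm) :
    ∃ (N : Submodule ℝ H) (c : ℝ), FiniteDimensional ℝ N ∧ 0 < c ∧
      ∀ x ∈ Nᗮ, c * ‖x‖ ≤ ‖T x‖ := by
  obtain ⟨v, hv, -⟩ := hT.exists_isQuasiInverse
  have hfin := LinearMap.FiniteRangeSetoid.equiv_iff_eqLocus_coFG.1 hv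
  set V := LinearMap.eqLocus ((v : H →ₗ[ℝ] H) ∘ₗ (T : H →ₗ[ℝ] H)) LinearMap.id with hV
  have hVc : IsClosed (V : Set H) := isClosed_eq (v.continuous.comp T.continuous) continuous_id
  have : CompleteSpace V := hVc.completeSpace_coe
  -- On the closed subspace V of finite codimension the quasi-inverse v is a true left inverse, so
  -- ‖x‖ ≤ ‖v‖‖T x‖ there. Adding 1 avoids inverting zero.
  refine ⟨Vᗮ, (‖v‖ + 1)⁻¹, .of_fg (hfin.fg_of_isCompl V.isCompl_orthogonal),
    by positivity, fun x hx => ?_⟩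
  rw [Submodule.orthogonal_orthogonal] at hx
  have h1 : v (T x) = x := hx
  have hp : 0 < ‖v‖ + 1 := by positivity
  rw [inv_mul_le_iff₀ hp]
  calc ‖x‖ = ‖v (T x)‖ := by rw [h1]
    _ ≤ ‖v‖ * ‖T x‖ := v.le_opNorm _
    _ ≤ _ := mul_le_mul_of_nonneg_right (by linarith) (norm_nonneg _)

theorem spectralProjection_eq {a b : ℝ} {E : Submodule ℝ H} [E.HasOrthogonalProjection]
    (h : spectralSubspace T a b = E) : spectralProjection T a b = E.starProjection := by
  subst h
  rfl

omit [CompleteSpace H] in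
theorem starProjection_apply_comm (hT : (T : H →ₗ[ℝ] H).IsSymmetric) {E : Submodule ℝ H}
    [E.HasOrthogonalProjection] (hE : ∀ x ∈ E, T x ∈ E) (x : H) :
    E.starProjection (T x) = T (E.starProjection x) := by
  refine Submodule.eq_starProjection_of_mem_orthogonal
    (hE _ (Submodule.starProjection_apply_mem _ _)) ?_
  rw [← map_sub]
  exact apply_mem_orthogonal hT hE _ (Submodule.sub_starProjection_mem_orthogonal x)

omit [CompleteSpace H] in
-- With P, P' the projections and X = (1 - P')P, one has T'X = XTP - (1 - P')(T - T')P. The left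
-- side is at least b‖X x‖ at x and the first term on the right at most a‖X‖‖x‖; absorbing it leaves
-- (b - a)‖X‖ ≤ ‖T - T'‖.
theorem norm_one_sub_starProjection_comp_le (hT' : (T' : H →ₗ[ℝ] H).IsSymmetric)
    {E E' : Submodule ℝ H} [E.HasOrthogonalProjection] [E'.HasOrthogonalProjection]
    (hE : ∀ x ∈ E, T x ∈ E) (hE' : ∀ x ∈ E', T' x ∈ E') {a b : ℝ} (hab : a < b) (ha0 : 0 ≤ a)
    (ha : ∀ x ∈ E, ‖T x‖ ≤ a * ‖x‖) (hb : ∀ x ∈ E'ᗮ, b * ‖x‖ ≤ ‖T' x‖) :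
    ‖(1 - E'.starProjection) * E.starProjection‖ ≤ ‖T - T'‖ / (b - a) := by
  set X := (1 - E'.starProjection) * E.starProjection with hX
  have hb0 : 0 < b := ha0.trans_lt hab
  have key : ∀ x, ‖X x‖ ≤ (‖T - T'‖ + a * ‖X‖) / b * ‖x‖ := fun x => by
    set p := E.starProjection x
    have hpE : p ∈ E := Submodule.starProjection_apply_mem _ _
    have hp : ‖p‖ ≤ ‖x‖ := E.norm_starProjection_apply_le x
    have hXx : X x = p - E'.starProjection p := by simp [hX, p]
    have h1 : b * ‖X x‖ ≤ ‖T' (X x)‖ :=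
      hb _ (by rw [hXx]; exact Submodule.sub_starProjection_mem_orthogonal p)
    have hXT : X (T p) = T p - E'.starProjection (T p) := by
      simp [hX, Submodule.starProjection_eq_self_iff.2 (hE p hpE)]
    have h2 : T' (X x) = X (T p) -
        ((T - T') p - E'.starProjection ((T - T') p)) := by
      rw [hXx, hXT, map_sub, ← starProjection_apply_comm hT' hE']
      simp only [sub_apply, map_sub]
      abel
    have h3 : ‖(T - T') p - E'.starProjection ((T - T') p)‖ ≤ ‖T - T'‖ * ‖x‖ := by
      have e1 : ‖(T - T') p - E'.starProjection ((T - T') p)‖ ≤ ‖(T - T') p‖ := by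
        rw [← Submodule.starProjection_orthogonal_val]
        exact E'ᗮ.norm_starProjection_apply_le _
      exact e1.trans (((T - T').le_opNorm p).trans
        (mul_le_mul_of_nonneg_left hp (norm_nonneg _)))
    have h4 : ‖X (T p)‖ ≤ ‖X‖ * (a * ‖x‖) := (X.le_opNorm _).trans
      (mul_le_mul_of_nonneg_left ((ha p hpE).trans (mul_le_mul_of_nonneg_left hp ha0))
        (norm_nonneg _))
    have h5 : ‖T' (X x)‖ ≤ ‖X‖ * (a * ‖x‖) + ‖T - T'‖ * ‖x‖ := by
      rw [h2]; exact (norm_sub_le _ _).trans (add_le_add h4 h3)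
    rw [div_mul_eq_mul_div, le_div_iff₀ hb0]
    linarith
  have h := X.opNorm_le_bound (by positivity) key
  rw [le_div_iff₀ hb0] at h
  rw [le_div_iff₀ (sub_pos.2 hab)]
  linarith

/-- The spectral projections depend Lipschitz continuously on the operator across a gap. -/
theorem norm_starProjection_sub_le (hT : (T : H →ₗ[ℝ] H).IsSymmetric)
    (hT' : (T' : H →ₗ[ℝ] H).IsSymmetric)
    {E E' : Submodule ℝ H} [E.HasOrthogonalProjection] [E'.HasOrthogonalProjection]
    (hE : ∀ x ∈ E, T x ∈ E) (hE' : ∀ x ∈ E', T' x ∈ E') {a b : ℝ} (hab : a < b) (ha0 : 0 ≤ a)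
    (ha : ∀ x ∈ E, ‖T x‖ ≤ a * ‖x‖) (hb : ∀ x ∈ Eᗮ, b * ‖x‖ ≤ ‖T x‖)
    (ha' : ∀ x ∈ E', ‖T' x‖ ≤ a * ‖x‖) (hb' : ∀ x ∈ E'ᗮ, b * ‖x‖ ≤ ‖T' x‖) :
    ‖E.starProjection - E'.starProjection‖ ≤ 2 / (b - a) * ‖T - T'‖ := by
  have h1 := norm_one_sub_starProjection_comp_le hT' hE hE' hab ha0 ha hb'
  have h2 := norm_one_sub_starProjection_comp_le hT hE' hE hab ha0 ha' hb
  -- The adjoint of this product is the one estimated in `h2`, with the roles of the two operators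
  -- exchanged.
  have h3 : ‖E'.starProjection * (1 - E.starProjection)‖ ≤ ‖T' - T‖ / (b - a) := by
    rw [← norm_star, star_mul, star_sub, star_one, (isSelfAdjoint_starProjection E).star_eq,
      (isSelfAdjoint_starProjection E').star_eq]
    exact h2
  have h4 : E.starProjection - E'.starProjection = (1 - E'.starProjection) * E.starProjection -
      E'.starProjection * (1 - E.starProjection) := by noncomm_ring
  rw [h4]
  refine (norm_sub_le _ _).trans ((add_le_add h1 h3).trans (le_of_eq ?_))
  rw [norm_sub_rev T' T]; ring

/-- A dimension count: the eigenvectors of T' for [-a₂, a₂] span a space meeting Nᗮ trivially, hence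
of dimension at most dim N, while N embeds into the span for [-a₁, a₁]. The two spans coincide, so
the gap of T' beyond a₂ already starts at a₁. -/
theorem gap_of_norm_sub_le (hT' : (T' : H →ₗ[ℝ] H).IsSymmetric)
    {N : Submodule ℝ H} [FiniteDimensional ℝ N] {a b a₁ a₂ : ℝ} (ha0 : 0 ≤ a)
    (ha : ∀ x ∈ N, ‖T x‖ ≤ a * ‖x‖) (hb : ∀ x ∈ Nᗮ, b * ‖x‖ ≤ ‖T x‖)
    (h1 : a + ‖T' - T‖ ≤ a₁) (h12 : a₁ ≤ a₂) (h2 : a₂ < b - ‖T' - T‖) :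
    ∀ x ∈ (eigenSpan T' (Set.Icc (-a₁) a₁))ᗮ, a₂ * ‖x‖ ≤ ‖T' x‖ := by
  have hd : ∀ x, ‖T' x - T x‖ ≤ ‖T' - T‖ * ‖x‖ := fun x => (T' - T).le_opNorm x
  have hc : ∀ x ∈ Nᗮ, (b - ‖T' - T‖) * ‖x‖ ≤ ‖T' x‖ := fun x hx => by
    have e1 := norm_sub_norm_le (T x) (T' x)
    rw [norm_sub_rev] at e1
    have := hb x hx
    have := hd x
    linarith
  have ha' : ∀ x ∈ N, ‖T' x‖ ≤ a₁ * ‖x‖ := fun x hx => by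
    have e1 := norm_sub_norm_le (T' x) (T x)
    have e2 := ha x hx
    have e3 := hd x
    have e4 := mul_le_mul_of_nonneg_right h1 (norm_nonneg x)
    linarith
  have ha₁ : 0 ≤ a₁ := by linarith [norm_nonneg (T' - T)]
  have := finiteDimensional_eigenSpan hT' hc (h12.trans_lt h2)
  have := finiteDimensional_eigenSpan hT' hc h2
  obtain ⟨b₁, hb₁, hgap₁⟩ := exists_gap hT' hc ha₁ (h12.trans_lt h2)
  obtain ⟨b₂, hb₂, hgap₂⟩ := exists_gap hT' hc (ha₁.trans h12) h2
  have hle : Module.finrank ℝ (eigenSpan T' (Set.Icc (-a₂) a₂)) ≤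
      Module.finrank ℝ (eigenSpan T' (Set.Icc (-a₁) a₁)) :=
    (finrank_le_of_disjoint_orthogonal (disjoint_orthogonal_of_norm_le hc h2
      fun _ => norm_apply_le_of_mem_eigenSpan hT' subset_rfl)).trans
    (finrank_le_of_disjoint_orthogonal (disjoint_orthogonal_of_norm_le hgap₁ hb₁ ha'))
  have heq := Submodule.eq_of_le_of_finrank_le
    (eigenSpan_mono (T := T') (Set.Icc_subset_Icc (neg_le_neg h12) h12)) hle
  rw [heq]
  exact fun x hx => (mul_le_mul_of_nonneg_right hb₂.le (norm_nonneg x)).trans (hgap₂ x hx)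

/-- Near a selfadjoint Fredholm operator, the spectral projections of suitable intervals
`[-a, a]` have finite rank and depend continuously on the operator. -/
theorem exists_radius_spectralProjection (hT : IsSelfAdjointFredholm T) :
    ∃ a > 0, ∃ ε > 0,
      (∀ S : H →L[ℝ] H, IsSelfAdjoint S → ‖S - T‖ ≤ ε →
        FiniteDimensional ℝ (spectralSubspace S (-a) a)) ∧
      ∃ C : ℝ, ∀ S S' : H →L[ℝ] H, IsSelfAdjoint S → ‖S - T‖ ≤ ε → IsSelfAdjoint S' →
        ‖S' - T‖ ≤ ε →
        ‖spectralProjection S (-a) a - spectralProjection S' (-a) a‖ ≤ C * ‖S - S'‖ := by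
  obtain ⟨N, c, hN, hc0, hc⟩ := exists_bounded_below_of_isFredholm hT.2
  have hTs := hT.1.isSymmetric
  have hac : c / 2 < c := by linarith
  obtain ⟨b, hb, hgap⟩ := exists_gap hTs hc (by positivity) hac
  have := finiteDimensional_eigenSpan hTs hc hac
  set F := eigenSpan T (Set.Icc (-(c / 2)) (c / 2))
  have hF : ∀ x ∈ F, ‖T x‖ ≤ c / 2 * ‖x‖ := fun _ => norm_apply_le_of_mem_eigenSpan hTs subset_rfl
  -- The gap of T from c/2 to b has length 8ε, and a is its midpoint. Operators within ε of T keep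
  -- the gap from a to a + 2ε, whose length gives the Lipschitz constant.
  set ε := (b - c / 2) / 8 with hε
  have hε0 : 0 < ε := by simp only [hε]; linarith
  set a := c / 2 + 4 * ε with ha
  have ha0 : 0 < a := by positivity
  have hbelow : ∀ S : H →L[ℝ] H, ‖S - T‖ ≤ ε → ∀ x ∈ Fᗮ, (b - ε) * ‖x‖ ≤ ‖S x‖ := by
    intro S hS x hx
    have e1 := norm_sub_norm_le (T x) (S x)
    rw [norm_sub_rev] at e1
    have e2 := hgap x hx
    have e3 : ‖S x - T x‖ ≤ ε * ‖x‖ := (S - T).le_of_opNorm_le hS x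
    linarith
  have hab : a < b - ε := by simp only [ha]; linarith
  refine ⟨a, ha0, ε, hε0, fun S hS h => ?_, 2 / (a + 2 * ε - a), fun S S' hS h hS' h' => ?_⟩
  · rw [spectralSubspace_eq_eigenSpan_of_lt hS.isSymmetric (hbelow S h) hab]
    exact finiteDimensional_eigenSpan hS.isSymmetric (hbelow S h) hab
  · have := finiteDimensional_eigenSpan hS.isSymmetric (hbelow S h) hab
    have := finiteDimensional_eigenSpan hS'.isSymmetric (hbelow S' h') hab
    rw [spectralProjection_eq (spectralSubspace_eq_eigenSpan_of_lt hS.isSymmetric (hbelow S h) hab),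
      spectralProjection_eq
        (spectralSubspace_eq_eigenSpan_of_lt hS'.isSymmetric (hbelow S' h') hab)]
    have hg : ∀ R : H →L[ℝ] H, IsSelfAdjoint R → ‖R - T‖ ≤ ε →
        ∀ x ∈ (eigenSpan R (Set.Icc (-a) a))ᗮ, (a + 2 * ε) * ‖x‖ ≤ ‖R x‖ := fun R hR hRT =>
      gap_of_norm_sub_le hR.isSymmetric (by positivity) hF hgap (by linarith) (by linarith)
        (by linarith)
    exact norm_starProjection_sub_le hS.isSymmetric hS'.isSymmetric
      (fun _ => apply_mem_eigenSpan) (fun _ => apply_mem_eigenSpan) (by linarith) ha0.le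
      (fun _ => norm_apply_le_of_mem_eigenSpan hS.isSymmetric subset_rfl) (hg S hS h)
      (fun _ => norm_apply_le_of_mem_eigenSpan hS'.isSymmetric subset_rfl) (hg S' hS' h')

open Filter Topology in
theorem exists_nhds_spectralProjection {L : unitInterval → H →L[ℝ] H} (hL : IsFSPath L)
    (t₀ : unitInterval) : ∃ U : Set unitInterval, IsOpen U ∧ t₀ ∈ U ∧ ∃ a > 0,
      (∀ t ∈ U, FiniteDimensional ℝ (spectralSubspace (L t) (-a) a)) ∧
      ContinuousOn (fun t => spectralProjection (L t) (-a) a) U := by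
  obtain ⟨a, ha, ε, hε, hfin, C, hC⟩ := exists_radius_spectralProjection (hL.2 t₀)
  have hsub : ∀ t ∈ {t | ‖L t - L t₀‖ < ε}, ‖L t - L t₀‖ ≤ ε := fun t ht => le_of_lt ht
  refine ⟨{t | ‖L t - L t₀‖ < ε}, isOpen_lt (hL.1.sub continuous_const).norm continuous_const,
    by simpa using hε, a, ha, fun t ht => hfin _ (hL.2 t).1 (hsub t ht), fun s hs => ?_⟩
  rw [ContinuousWithinAt, tendsto_iff_norm_sub_tendsto_zero]
  have hlim : Tendsto (fun t => C * ‖L t - L s‖) (𝓝[{t | ‖L t - L t₀‖ < ε}] s) (𝓝 0) := by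
    have h : Continuous fun t => C * ‖L t - L s‖ :=
      continuous_const.mul (hL.1.sub continuous_const).norm
    have := h.continuousWithinAt (s := {t | ‖L t - L t₀‖ < ε}) (x := s)
    simpa [ContinuousWithinAt] using this
  refine squeeze_zero' (Eventually.of_forall fun _ => norm_nonneg _) ?_ hlim
  filter_upwards [self_mem_nhdsWithin] with t ht
  exact hC _ _ (hL.2 t).1 (hsub t ht) (hL.2 s).1 (hsub s hs)

/-- Admissible partitions exist. -/
theorem nonempty_spectralPartition {L : unitInterval → H →L[ℝ] H} (hL : IsFSPath L) :
    Nonempty (SpectralPartition L) := by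
  choose U hU htU a ha hfin hcont using exists_nhds_spectralProjection hL
  obtain ⟨δ, hδ, hball⟩ := lebesgue_number_lemma_of_metric (isCompact_univ (X := unitInterval)) hU
    (fun t _ => Set.mem_iUnion.2 ⟨t, htU t⟩)
  -- Equal subintervals of length 1/(n + 1), below the Lebesgue number, each lie in one of the sets
  -- U.
  obtain ⟨n, hn⟩ := exists_nat_one_div_lt hδ
  choose c hc using fun t => hball t (Set.mem_univ t)
  have hpos : (0 : ℝ) < n + 1 := by positivity
  set node : Fin (n + 1 + 1) → unitInterval := fun i => ⟨(i : ℝ) / (n + 1), by positivity, by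
    rw [div_le_one hpos]
    exact_mod_cast Nat.lt_succ_iff.1 i.2⟩ with hnode
  have hmem : ∀ i : Fin (n + 1), Set.Icc (node i.castSucc) (node i.succ) ⊆
      U (c (node i.castSucc)) := by
    intro i t ht
    refine hc _ ?_
    rw [Metric.mem_ball, Subtype.dist_eq, Real.dist_eq, abs_of_nonneg
      (sub_nonneg.2 (show ((node i.castSucc : unitInterval) : ℝ) ≤ t from ht.1))]
    refine lt_of_le_of_lt ?_ hn
    have h2 : (t : ℝ) ≤ ((i : ℝ) + 1) / (n + 1) := by
      have h := ht.2
      rw [← Subtype.coe_le_coe] at h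
      simpa [hnode] using h
    have h3 : ((node i.castSucc : unitInterval) : ℝ) = (i : ℝ) / (n + 1) := by simp [hnode]
    rw [h3, sub_le_iff_le_add, ← add_div]
    rwa [add_comm] at h2
  exact ⟨{
    N := n + 1
    node := node
    node_strictMono := fun i j hij => by
      rw [← Subtype.coe_lt_coe]
      exact div_lt_div_of_pos_right (by exact_mod_cast hij) hpos
    node_zero := by ext; simp [hnode]
    node_last := by ext; simp [hnode, div_self hpos.ne']
    a := fun i => a (c (node i.castSucc))
    a_pos := fun i => ha _
    finiteRank := fun i t ht => hfin _ t (hmem i ht)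
    continuousOn := fun i => (hcont _).mono (hmem i) }⟩

end LocalGap

/-! ### Comparison of two cutoffs on one interval -/

section Comparison

variable {H : Type*} [NormedAddCommGroup H] [InnerProductSpace ℝ H]

/-- A vector in E orthogonal to E' is fixed by the difference of the projections, so it vanishes if
the difference has norm below 1. -/
theorem finrank_le_of_norm_starProjection_sub_lt {E E' : Submodule ℝ H}
    [E.HasOrthogonalProjection] [FiniteDimensional ℝ E']
    (h : ‖E.starProjection - E'.starProjection‖ < 1) :
    Module.finrank ℝ E ≤ Module.finrank ℝ E' := by
  refine finrank_le_of_disjoint_orthogonal (Submodule.disjoint_def.2 fun x hx hx' => ?_)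
  by_contra h0
  have hpos : 0 < ‖x‖ := norm_pos_iff.2 h0
  have h1 := (E.starProjection - E'.starProjection).le_opNorm x
  rw [sub_apply, Submodule.starProjection_eq_self_iff.2 hx,
    (E'.starProjection_apply_eq_zero_iff).2 hx', sub_zero] at h1
  nlinarith

theorem finrank_eq_of_norm_starProjection_sub_lt {E E' : Submodule ℝ H}
    [FiniteDimensional ℝ E] [FiniteDimensional ℝ E']
    (h : ‖E.starProjection - E'.starProjection‖ < 1) :
    Module.finrank ℝ E = Module.finrank ℝ E' :=
  le_antisymm (finrank_le_of_norm_starProjection_sub_lt h)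
    (finrank_le_of_norm_starProjection_sub_lt (by rwa [norm_sub_rev]))

/-- The number of eigenvalues in `(b, a]` does not decrease under small perturbations. -/
theorem finrank_eigenSpan_Ioc_le {T T' : H →L[ℝ] H} (hT : (T : H →ₗ[ℝ] H).IsSymmetric)
    (hT' : (T' : H →ₗ[ℝ] H).IsSymmetric) {a b : ℝ} (hb : 0 < b) (hba : b ≤ a)
    {E F E' F' : Submodule ℝ H}
    (hE : E = eigenSpan T (Set.Icc (-a) a)) (hF : F = eigenSpan T (Set.Icc (-b) b))
    (hE' : E' = eigenSpan T' (Set.Icc (-a) a)) (hF' : F' = eigenSpan T' (Set.Icc (-b) b))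
    [FiniteDimensional ℝ E] [FiniteDimensional ℝ F]
    [FiniteDimensional ℝ E'] [FiniteDimensional ℝ F']
    (h : ‖(E'.starProjection - F'.starProjection) * T' * (E'.starProjection - F'.starProjection) -
      (E.starProjection - F.starProjection) * T * (E.starProjection - F.starProjection)‖ < b) :
    Module.finrank ℝ (eigenSpan T (Set.Ioc b a)) ≤
      Module.finrank ℝ (eigenSpan T' (Set.Ioc b a)) := by
  have hsub : Set.Ioc b a ⊆ Set.Icc (-a) a := fun x hx => ⟨by linarith [hx.1, hx.2], hx.2⟩
  have hbsub : Set.Icc (-b) b ⊆ Set.Icc (-a) a := Set.Icc_subset_Icc (neg_le_neg hba) hba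
  have hFE' : F' ≤ E' := by rw [hE', hF']; exact eigenSpan_mono hbsub
  have hW' : FiniteDimensional ℝ (eigenSpan T' (Set.Ioc b a)) :=
    Submodule.finiteDimensional_of_le ((eigenSpan_mono hsub).trans hE'.ge)
  set W := eigenSpan T (Set.Ioc b a) with hW
  set W' := eigenSpan T' (Set.Ioc b a) with hWd'
  set R := E.starProjection - F.starProjection with hR
  set R' := E'.starProjection - F'.starProjection with hR'
  -- If f kills w, then R'w lies in the span of eigenvectors for [-a, -b), so the form of R'T'R' at
  -- w is at most 0. The form of RTR at w is at least b‖w‖², and the two forms differ by less than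
  -- b‖w‖² unless w = 0.
  let f : W →ₗ[ℝ] W' :=
    ((W'.orthogonalProjectionOnto ∘L R' : H →L[ℝ] W') : H →ₗ[ℝ] W').domRestrict W
  refine LinearMap.finrank_le_finrank_of_injective (f := f) ((injective_iff_map_eq_zero _).2 ?_)
  rintro ⟨w, hw⟩ hfw
  have hfw' : R' w ∈ W'ᗮ := Submodule.orthogonalProjectionOnto_eq_zero_iff.1 hfw
  have hRw : R w = w := by
    have h1 : E.starProjection w = w :=
      Submodule.starProjection_eq_self_iff.2 (hE.ge (eigenSpan_mono hsub hw))
    have h2 : F.starProjection w = 0 := by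
      rw [Submodule.starProjection_apply_eq_zero_iff, hF]
      refine (eigenSpan_isOrtho hT ?_ : eigenSpan T (Set.Ioc b a) ≤ _) hw
      exact Set.disjoint_left.2 fun x hx hx' => absurd hx.1 (not_lt.2 hx'.2)
    rw [hR, sub_apply, h1, h2, sub_zero]
  have hmem : R' w ∈ eigenSpan T' ((Set.Icc (-a) a \ Set.Icc (-b) b) \ Set.Ioc b a) := by
    have hd : Set.Ioc b a ⊆ Set.Icc (-a) a \ Set.Icc (-b) b := fun x hx =>
      ⟨hsub hx, fun hx' => absurd hx.1 (not_lt.2 hx'.2)⟩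
    rw [← eigenSpan_inf_orthogonal hT' hd, ← eigenSpan_inf_orthogonal hT' hbsub, ← hE', ← hF']
    refine ⟨⟨E'.sub_mem (Submodule.starProjection_apply_mem _ _)
      (hFE' (Submodule.starProjection_apply_mem _ _)), ?_⟩, hfw'⟩
    intro y hy
    rw [hR', sub_apply, inner_sub_right, ← Submodule.inner_starProjection_left_eq_right,
      ← Submodule.inner_starProjection_left_eq_right,
      Submodule.starProjection_eq_self_iff.2 hy,
      Submodule.starProjection_eq_self_iff.2 (hFE' hy), sub_self]
  have hneg : inner ℝ (T' (R' w)) (R' w) ≤ 0 := by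
    have := inner_apply_le_of_mem_eigenSpan (b := 0) hT' (fun μ hμ => ?_) hmem
    · simpa using this
    · by_contra hμ0
      rw [not_le] at hμ0
      refine hμ.2 ⟨?_, hμ.1.1.2⟩
      by_contra hμb
      exact hμ.1.2 ⟨by linarith, not_lt.1 hμb⟩
  have hsymm : ∀ x y, inner ℝ (R' x) y = inner ℝ x (R' y) := fun x y => by
    simp only [hR', sub_apply, inner_sub_left, inner_sub_right,
      Submodule.inner_starProjection_left_eq_right]
  have hsymmR : ∀ x y, inner ℝ (R x) y = inner ℝ x (R y) := fun x y => by
    simp only [hR, sub_apply, inner_sub_left, inner_sub_right,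
      Submodule.inner_starProjection_left_eq_right]
  have h1 : inner ℝ ((R' * T' * R' - R * T * R) w) w =
      inner ℝ (T' (R' w)) (R' w) - inner ℝ (T w) w := by
    simp only [sub_apply, mul_apply_eq_comp, inner_sub_left, hsymm, hsymmR, hRw]
  have h2 : b * ‖w‖ ^ 2 ≤ inner ℝ (T w) w :=
    le_inner_apply_of_mem_eigenSpan hT (fun μ hμ => hμ.1.le) hw
  have h3 : |inner ℝ ((R' * T' * R' - R * T * R) w) w| ≤ ‖R' * T' * R' - R * T * R‖ * ‖w‖ ^ 2 := by
    refine (abs_real_inner_le_norm _ _).trans ?_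
    rw [sq, ← mul_assoc]
    exact mul_le_mul_of_nonneg_right (ContinuousLinearMap.le_opNorm _ _) (norm_nonneg _)
  by_contra hw0
  have hwpos : 0 < ‖w‖ ^ 2 := by
    have : w ≠ 0 := fun h => hw0 (Subtype.ext h)
    positivity
  have h4 := neg_abs_le (inner ℝ ((R' * T' * R' - R * T * R) w) w)
  have h5 := mul_lt_mul_of_pos_right h hwpos
  linarith

/-- The number of eigenvalues in `[-a, -b)` does not decrease under small perturbations. -/
theorem finrank_eigenSpan_Ico_le {T T' : H →L[ℝ] H} (hT : (T : H →ₗ[ℝ] H).IsSymmetric)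
    (hT' : (T' : H →ₗ[ℝ] H).IsSymmetric) {a b : ℝ} (hb : 0 < b) (hba : b ≤ a)
    {E F E' F' : Submodule ℝ H}
    (hE : E = eigenSpan T (Set.Icc (-a) a)) (hF : F = eigenSpan T (Set.Icc (-b) b))
    (hE' : E' = eigenSpan T' (Set.Icc (-a) a)) (hF' : F' = eigenSpan T' (Set.Icc (-b) b))
    [FiniteDimensional ℝ E] [FiniteDimensional ℝ F]
    [FiniteDimensional ℝ E'] [FiniteDimensional ℝ F']
    (h : ‖(E'.starProjection - F'.starProjection) * T' * (E'.starProjection - F'.starProjection) -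
      (E.starProjection - F.starProjection) * T * (E.starProjection - F.starProjection)‖ < b) :
    Module.finrank ℝ (eigenSpan T (Set.Ico (-a) (-b))) ≤
      Module.finrank ℝ (eigenSpan T' (Set.Ico (-a) (-b))) := by
  have hIcc : ∀ (S : H →L[ℝ] H) (r : ℝ),
      eigenSpan S (Set.Icc (-r) r) = eigenSpan (-S) (Set.Icc (-r) r) := fun S r => by
    rw [eigenSpan_neg, Set.neg_Icc, neg_neg]
  have hIco : ∀ S : H →L[ℝ] H, eigenSpan S (Set.Ico (-a) (-b)) = eigenSpan (-S) (Set.Ioc b a) :=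
    fun S => by rw [eigenSpan_neg, Set.neg_Ioc]
  have hsymm : ∀ {S : H →L[ℝ] H}, (S : H →ₗ[ℝ] H).IsSymmetric →
      ((-S : H →L[ℝ] H) : H →ₗ[ℝ] H).IsSymmetric := fun {S} hS x y => by
    have := hS x y
    simpa using this
  rw [hIco, hIco]
  refine finrank_eigenSpan_Ioc_le (hsymm hT) (hsymm hT') hb hba (hE.trans (hIcc _ _))
    (hF.trans (hIcc _ _)) (hE'.trans (hIcc _ _)) (hF'.trans (hIcc _ _)) ?_
  rw [← norm_neg]
  refine lt_of_eq_of_lt (congrArg _ ?_) h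
  noncomm_ring

variable [CompleteSpace H]

/-- If `χ_[-a,a](L t)` and `χ_[-b,b](L t)` are continuous families of projections of finite rank,
then the number of eigenvalues in `(b, a]` is constant. -/
theorem finrank_spectralSubspace_sub_eq_of_le {L : unitInterval → H →L[ℝ] H} (hLc : Continuous L)
    (hLs : ∀ t, IsSelfAdjoint (L t)) {J : Set unitInterval} (hJ : IsPreconnected J) {a b : ℝ}
    (hb : 0 < b) (hba : b ≤ a)
    (hfin : ∀ t ∈ J, FiniteDimensional ℝ (spectralSubspace (L t) (-a) a))
    (hca : ContinuousOn (fun t => spectralProjection (L t) (-a) a) J)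
    (hcb : ContinuousOn (fun t => spectralProjection (L t) (-b) b) J) {s t : unitInterval}
    (hs : s ∈ J) (ht : t ∈ J) :
    (Module.finrank ℝ (spectralSubspace (L t) 0 a) : ℤ) -
        Module.finrank ℝ (spectralSubspace (L s) 0 a) =
      Module.finrank ℝ (spectralSubspace (L t) 0 b) -
        Module.finrank ℝ (spectralSubspace (L s) 0 b) := by
  have hsym := fun t => (hLs t).isSymmetric
  have hfinb : ∀ t ∈ J, FiniteDimensional ℝ (spectralSubspace (L t) (-b) b) := fun t ht =>
    have := hfin t ht
    Submodule.finiteDimensional_of_le (spectralSubspace_mono _ (neg_le_neg hba) hba)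
  have hEa := fun t ht => spectralSubspace_eq_eigenSpan (hsym t) (hfin t ht)
  have hEb := fun t ht => spectralSubspace_eq_eigenSpan (hsym t) (hfinb t ht)
  have hfinS : ∀ t ∈ J, ∀ S ⊆ Set.Icc (-a) a, FiniteDimensional ℝ (eigenSpan (L t) S) :=
    fun t ht S hS => by
      have := hfin t ht
      exact Submodule.finiteDimensional_of_le ((eigenSpan_mono hS).trans (hEa t ht).ge)
  have ha : 0 < a := hb.trans_le hba
  -- This reduces the claim to constancy of the number of eigenvalues in (b, a].
  have hd : ∀ t ∈ J, Module.finrank ℝ (spectralSubspace (L t) 0 a) =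
      Module.finrank ℝ (spectralSubspace (L t) 0 b) +
        Module.finrank ℝ (eigenSpan (L t) (Set.Ioc b a)) := fun t ht => by
    have := hfin t ht
    have h0a : FiniteDimensional ℝ (spectralSubspace (L t) 0 a) :=
      Submodule.finiteDimensional_of_le (spectralSubspace_mono _ (neg_nonpos.2 ha.le) le_rfl)
    have h0b : FiniteDimensional ℝ (spectralSubspace (L t) 0 b) :=
      Submodule.finiteDimensional_of_le (spectralSubspace_mono _ le_rfl hba)
    have := hfinS t ht (Set.Icc 0 b) (Set.Icc_subset_Icc (by linarith) hba)
    have := hfinS t ht (Set.Ioc b a) (fun x hx => ⟨by linarith [hx.1, hx.2], hx.2⟩)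
    rw [spectralSubspace_eq_eigenSpan (hsym t) h0a, spectralSubspace_eq_eigenSpan (hsym t) h0b,
      ← finrank_eigenSpan_union (hsym t), Set.Icc_union_Ioc_eq_Icc hb.le hba]
    exact Set.disjoint_left.2 fun x hx hx' => absurd hx'.1 (not_lt.2 hx.2)
  have htot : ∀ t ∈ J, Module.finrank ℝ (spectralSubspace (L t) (-a) a) =
      Module.finrank ℝ (spectralSubspace (L t) (-b) b) +
        (Module.finrank ℝ (eigenSpan (L t) (Set.Ico (-a) (-b))) +
          Module.finrank ℝ (eigenSpan (L t) (Set.Ioc b a))) := fun t ht => by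
    have := hfinS t ht (Set.Icc (-b) b) (Set.Icc_subset_Icc (by linarith) hba)
    have := hfinS t ht (Set.Ioc b a) (fun x hx => ⟨by linarith [hx.1, hx.2], hx.2⟩)
    have := hfinS t ht (Set.Ico (-a) (-b)) (fun x hx => ⟨hx.1, by linarith [hx.1, hx.2]⟩)
    have := hfinS t ht (Set.Ico (-a) (-b) ∪ Set.Ioc b a) (by
      rintro x (hx | hx)
      · exact ⟨hx.1, by linarith [hx.1, hx.2]⟩
      · exact ⟨by linarith [hx.1, hx.2], hx.2⟩)
    rw [hEa t ht, hEb t ht, ← finrank_eigenSpan_union (hsym t), ← finrank_eigenSpan_union (hsym t)]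
    · refine congrArg (fun S => Module.finrank ℝ (eigenSpan (L t) S)) (Set.ext fun x => ?_)
      change _ ↔ _ ∨ _ ∨ _
      constructor
      · rintro ⟨h1, h2⟩
        by_cases h3 : x < -b
        · exact Or.inr (Or.inl ⟨h1, h3⟩)
        by_cases h4 : b < x
        · exact Or.inr (Or.inr ⟨h4, h2⟩)
        · exact Or.inl ⟨not_lt.1 h3, not_lt.1 h4⟩
      · rintro (h | h | h) <;> constructor <;> linarith [h.1, h.2]
    · refine Set.disjoint_left.2 ?_
      rintro x hx (hx' | hx')
      · exact absurd hx'.2 (not_lt.2 hx.1)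
      · exact absurd hx'.1 (not_lt.2 hx.2)
    · exact Set.disjoint_left.2 fun x hx hx' => by linarith [hx.2, hx'.1]
  have hloc : ContinuousOn (fun t => Module.finrank ℝ (eigenSpan (L t) (Set.Ioc b a))) J := by
    intro t₀ ht₀
    have hA : ContinuousOn (fun t => (spectralProjection (L t) (-a) a -
        spectralProjection (L t) (-b) b) * L t * (spectralProjection (L t) (-a) a -
        spectralProjection (L t) (-b) b)) J :=
      ((hca.sub hcb).mul hLc.continuousOn).mul (hca.sub hcb)
    have e1 := Metric.tendsto_nhds.1 (hca t₀ ht₀) 1 one_pos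
    have e2 := Metric.tendsto_nhds.1 (hcb t₀ ht₀) 1 one_pos
    have e3 := Metric.tendsto_nhds.1 (hA t₀ ht₀) b hb
    refine (continuousWithinAt_const
      (b := Module.finrank ℝ (eigenSpan (L t₀) (Set.Ioc b a)))).congr_of_eventuallyEq ?_ rfl
    filter_upwards [e1, e2, e3, self_mem_nhdsWithin] with t e1 e2 e3 ht
    have := hfin t ht
    have := hfinb t ht
    have := hfin t₀ ht₀
    have := hfinb t₀ ht₀
    rw [dist_eq_norm, spectralProjection_eq rfl, spectralProjection_eq rfl] at e1 e2
    rw [dist_eq_norm, spectralProjection_eq rfl, spectralProjection_eq rfl,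
      spectralProjection_eq rfl, spectralProjection_eq rfl] at e3
    have f1 := finrank_eq_of_norm_starProjection_sub_lt e1
    have f2 := finrank_eq_of_norm_starProjection_sub_lt e2
    have f3 := finrank_eigenSpan_Ioc_le (hsym t₀) (hsym t) hb hba (hEa t₀ ht₀) (hEb t₀ ht₀)
      (hEa t ht) (hEb t ht) e3
    have f4 := finrank_eigenSpan_Ico_le (hsym t₀) (hsym t) hb hba (hEa t₀ ht₀) (hEb t₀ ht₀)
      (hEa t ht) (hEb t ht) e3
    -- By `f1` and `f2` the sum of the counts in [-a, -b) and (b, a] is the same at t and t₀; as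
    -- neither count is smaller at t, both agree.
    have f5 := htot t ht
    have f6 := htot t₀ ht₀
    omega
  have := hJ.constant hloc hs ht
  have h1 := hd s hs
  have h2 := hd t ht
  omega

theorem finrank_spectralSubspace_sub_eq {L : unitInterval → H →L[ℝ] H} (hLc : Continuous L)
    (hLs : ∀ t, IsSelfAdjoint (L t)) {J : Set unitInterval} (hJ : IsPreconnected J) {a b : ℝ}
    (ha : 0 < a) (hb : 0 < b)
    (hfa : ∀ t ∈ J, FiniteDimensional ℝ (spectralSubspace (L t) (-a) a))
    (hfb : ∀ t ∈ J, FiniteDimensional ℝ (spectralSubspace (L t) (-b) b))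
    (hca : ContinuousOn (fun t => spectralProjection (L t) (-a) a) J)
    (hcb : ContinuousOn (fun t => spectralProjection (L t) (-b) b) J) {s t : unitInterval}
    (hs : s ∈ J) (ht : t ∈ J) :
    (Module.finrank ℝ (spectralSubspace (L t) 0 a) : ℤ) -
        Module.finrank ℝ (spectralSubspace (L s) 0 a) =
      Module.finrank ℝ (spectralSubspace (L t) 0 b) -
        Module.finrank ℝ (spectralSubspace (L s) 0 b) := by
  rcases le_total b a with h | h
  · exact finrank_spectralSubspace_sub_eq_of_le hLc hLs hJ hb h hfa hca hcb hs ht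
  · exact (finrank_spectralSubspace_sub_eq_of_le hLc hLs hJ ha h hfb hcb hca hs ht).symm

end Comparison

/-! ### Independence of the admissible partition -/

section Independence

theorem sum_succ_sub_castSucc {A M : Type*} [AddCommGroup M] {n : ℕ} (f : A → M)
    (x : Fin (n + 1) → A) :
    ∑ i : Fin n, (f (x i.succ) - f (x i.castSucc)) = f (x (Fin.last n)) - f (x 0) := by
  have h1 := Fin.sum_univ_succ fun i => f (x i)
  have h2 := Fin.sum_univ_castSucc fun i => f (x i)
  rw [Finset.sum_sub_distrib, sub_eq_sub_iff_add_eq_add, add_comm, ← h1, h2, add_comm]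

/-- The map t ↦ max l (min u t) clamps t to [l, u]. Clamping the ends of either interval into the
other gives the ends of the intersection, or a single point when they are disjoint and both sides
vanish. This allows partitions to be compared without constructing a common refinement. -/
theorem sub_clamp_eq_sub_clamp {A M : Type*} [LinearOrder A] [AddCommGroup M] {l₁ u₁ l₂ u₂ : A}
    (h₁ : l₁ ≤ u₁) (h₂ : l₂ ≤ u₂) {f g : A → M}
    (h : ∀ x ∈ Set.Icc l₁ u₁ ∩ Set.Icc l₂ u₂, ∀ y ∈ Set.Icc l₁ u₁ ∩ Set.Icc l₂ u₂,
      f y - f x = g y - g x) :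
    f (max l₁ (min u₁ u₂)) - f (max l₁ (min u₁ l₂)) =
      g (max l₂ (min u₂ u₁)) - g (max l₂ (min u₂ l₁)) := by
  rcases lt_or_ge u₁ l₂ with h3 | h3
  · rw [min_eq_left (h3.le.trans h₂), min_eq_left h3.le, min_eq_right (h3.le.trans h₂),
      min_eq_right (h₁.trans (h3.le.trans h₂)), max_eq_left h3.le, max_eq_left (h₁.trans h3.le),
      sub_self, sub_self]
  rcases lt_or_ge u₂ l₁ with h4 | h4
  · rw [min_eq_left (h4.le.trans h₁), min_eq_left h4.le, min_eq_right (h4.le.trans h₁),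
      min_eq_right (h₂.trans (h4.le.trans h₁)), max_eq_left h4.le, max_eq_left (h₂.trans h4.le),
      sub_self, sub_self]
  rw [min_comm u₂ u₁, max_eq_right (le_min h₁ h4), max_eq_right (le_min h3 h₂), min_eq_right h3,
    min_eq_right h4, max_comm l₂ l₁]
  exact h _ ⟨⟨le_max_left _ _, max_le h₁ h3⟩, le_max_right _ _, max_le h4 h₂⟩ _
    ⟨⟨le_min h₁ h4, min_le_left _ _⟩, le_min h3 h₂, min_le_right _ _⟩

variable {H : Type*} [NormedAddCommGroup H] [InnerProductSpace ℝ H] [CompleteSpace H]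

/-- The sum defining the spectral flow does not depend on the admissible partition. -/
theorem SpectralPartition.flow_eq {L : unitInterval → H →L[ℝ] H} (hL : IsFSPath L)
    (p q : SpectralPartition L) : p.flow = q.flow := by
  -- Clamp all nodes of q into each interval of p; the inner sum telescopes to the contribution of
  -- that interval.
  have expand : ∀ p q : SpectralPartition L, p.flow = ∑ i : Fin p.N, ∑ j : Fin q.N,
      ((Module.finrank ℝ (spectralSubspace (L (max (p.node i.castSucc)
          (min (p.node i.succ) (q.node j.succ)))) 0 (p.a i)) : ℤ) -
        Module.finrank ℝ (spectralSubspace (L (max (p.node i.castSucc)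
          (min (p.node i.succ) (q.node j.castSucc)))) 0 (p.a i))) := by
    intro p q
    refine Finset.sum_congr rfl fun i _ => ?_
    have hle : p.node i.castSucc ≤ p.node i.succ :=
      p.node_strictMono.monotone i.castSucc_lt_succ.le
    rw [sum_succ_sub_castSucc (fun t => (Module.finrank ℝ (spectralSubspace (L (max
      (p.node i.castSucc) (min (p.node i.succ) t))) 0 (p.a i)) : ℤ)) q.node, q.node_zero,
      q.node_last, min_eq_left unitInterval.le_one', min_eq_right unitInterval.nonneg',
      max_eq_right hle, max_eq_left unitInterval.nonneg']
  rw [expand p q, expand q p, Finset.sum_comm]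
  refine Finset.sum_congr rfl fun j _ => Finset.sum_congr rfl fun i _ => ?_
  refine sub_clamp_eq_sub_clamp
    (f := fun t => (Module.finrank ℝ (spectralSubspace (L t) 0 (p.a i)) : ℤ))
    (g := fun t => (Module.finrank ℝ (spectralSubspace (L t) 0 (q.a j)) : ℤ))
    (p.node_strictMono.monotone i.castSucc_lt_succ.le)
    (q.node_strictMono.monotone j.castSucc_lt_succ.le) fun x hx y hy => ?_
  exact finrank_spectralSubspace_sub_eq hL.1 (fun t => (hL.2 t).1)
    (Set.ordConnected_Icc.inter Set.ordConnected_Icc).isPreconnected (p.a_pos i) (q.a_pos j)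
    (fun t ht => p.finiteRank i t ht.1) (fun t ht => q.finiteRank j t ht.2)
    ((p.continuousOn i).mono Set.inter_subset_left)
    ((q.continuousOn j).mono Set.inter_subset_right) hx hy

theorem hasSpectralFlow_flow {L : unitInterval → H →L[ℝ] H} (hL : IsFSPath L)
    (p : SpectralPartition L) : HasSpectralFlow L p.flow :=
  ⟨⟨p⟩, fun q => q.flow_eq hL p⟩

theorem HasSpectralFlow.sfl_eq {L : unitInterval → H →L[ℝ] H} {n : ℤ} (h : HasSpectralFlow L n) :
    sfl L = n := by
  have hex : ∃ n, HasSpectralFlow L n := ⟨n, h⟩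
  obtain ⟨p⟩ := h.1
  rw [sfl, dif_pos hex, ← hex.choose_spec.2 p, h.2 p]

end Independence

/-! ### Restriction to an invariant subspace and its complement -/

section Restrict

variable {H : Type*} [NormedAddCommGroup H] [InnerProductSpace ℝ H] {T : H →L[ℝ] H}
  {M : Submodule ℝ H} [M.HasOrthogonalProjection]

omit [M.HasOrthogonalProjection] in
theorem isSymmetric_restrict (hT : (T : H →ₗ[ℝ] H).IsSymmetric) (hM : ∀ x ∈ M, T x ∈ M) :
    (T.restrict hM : M →ₗ[ℝ] M).IsSymmetric := fun x y => hT x y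

theorem orthogonalProjectionOnto_apply_comm (hT : (T : H →ₗ[ℝ] H).IsSymmetric)
    (hM : ∀ x ∈ M, T x ∈ M) (x : H) :
    M.orthogonalProjectionOnto (T x) = T.restrict hM (M.orthogonalProjectionOnto x) :=
  Subtype.ext (starProjection_apply_comm hT hM x)

omit [M.HasOrthogonalProjection] in
theorem coe_mem_eigenSpan {hM : ∀ x ∈ M, T x ∈ M} {A : Set ℝ} {x : M}
    (hx : x ∈ eigenSpan (T.restrict hM) A) : (x : H) ∈ eigenSpan T A := by
  have : eigenSpan (T.restrict hM) A ≤ (eigenSpan T A).comap M.subtype :=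
    eigenSpan_le fun μ hμ x hx => mem_eigenSpan_of_apply_eq hμ (congrArg Subtype.val hx)
  exact this hx

/-- A symmetric operator commutes with the projection onto an invariant subspace, so projecting an
eigenvector gives an eigenvector of the restriction or zero. -/
theorem orthogonalProjectionOnto_mem_eigenSpan (hT : (T : H →ₗ[ℝ] H).IsSymmetric)
    (hM : ∀ x ∈ M, T x ∈ M) {A : Set ℝ} {x : H} (hx : x ∈ eigenSpan T A) :
    M.orthogonalProjectionOnto x ∈ eigenSpan (T.restrict hM) A := by
  have : eigenSpan T A ≤ (eigenSpan (T.restrict hM) A).comap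
      (M.orthogonalProjectionOnto : H →ₗ[ℝ] M) :=
    eigenSpan_le fun μ hμ x hx => mem_eigenSpan_of_apply_eq hμ (by
      rw [ContinuousLinearMap.coe_coe, ← orthogonalProjectionOnto_apply_comm hT, hx, map_smul])
  exact this hx

theorem map_eigenSpan_restrict (hT : (T : H →ₗ[ℝ] H).IsSymmetric) (hM : ∀ x ∈ M, T x ∈ M)
    (A : Set ℝ) : (eigenSpan (T.restrict hM) A).map M.subtype = eigenSpan T A ⊓ M := by
  ext x
  constructor
  · rintro ⟨y, hy, rfl⟩
    exact ⟨coe_mem_eigenSpan hy, y.2⟩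
  · rintro ⟨hx, hxM⟩
    refine ⟨_, orthogonalProjectionOnto_mem_eigenSpan hT hM hx, ?_⟩
    exact Submodule.starProjection_eq_self_iff.2 hxM

theorem finrank_eigenSpan_eq_add (hT : (T : H →ₗ[ℝ] H).IsSymmetric) (hM : ∀ x ∈ M, T x ∈ M)
    (hM' : ∀ x ∈ Mᗮ, T x ∈ Mᗮ) {A : Set ℝ}
    [FiniteDimensional ℝ (eigenSpan (T.restrict hM) A)]
    [FiniteDimensional ℝ (eigenSpan (T.restrict hM') A)] :
    Module.finrank ℝ (eigenSpan T A) = Module.finrank ℝ (eigenSpan (T.restrict hM) A) +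
      Module.finrank ℝ (eigenSpan (T.restrict hM') A) := by
  let f : eigenSpan T A →ₗ[ℝ] eigenSpan (T.restrict hM) A × eigenSpan (T.restrict hM') A :=
    ((M.orthogonalProjectionOnto : H →ₗ[ℝ] M).restrict
      fun x hx => orthogonalProjectionOnto_mem_eigenSpan hT hM hx).prod
    ((Mᗮ.orthogonalProjectionOnto : H →ₗ[ℝ] Mᗮ).restrict
      fun x hx => orthogonalProjectionOnto_mem_eigenSpan hT hM' hx)
  rw [← Module.finrank_prod]
  refine (LinearEquiv.ofBijective f ⟨(injective_iff_map_eq_zero _).2 fun x hx => ?_, ?_⟩).finrank_eq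
  · have h1 : M.orthogonalProjectionOnto (x : H) = 0 := congrArg (fun z => z.1.1) hx
    have h2 : Mᗮ.orthogonalProjectionOnto (x : H) = 0 := congrArg (fun z => z.2.1) hx
    rw [Submodule.orthogonalProjectionOnto_eq_zero_iff] at h1 h2
    exact Subtype.ext (inner_self_eq_zero.1 (h2 _ h1))
  · rintro ⟨⟨y, hy⟩, ⟨z, hz⟩⟩
    refine ⟨⟨y + z, Submodule.add_mem _ (coe_mem_eigenSpan hy) (coe_mem_eigenSpan hz)⟩, ?_⟩
    refine Prod.ext (Subtype.ext ?_) (Subtype.ext ?_)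
    · change M.orthogonalProjectionOnto ((y : H) + z) = y
      rw [map_add, Submodule.orthogonalProjectionOnto_mem_subspace_eq_self,
        Submodule.orthogonalProjectionOnto_eq_zero_iff.2 z.2, add_zero]
    · change Mᗮ.orthogonalProjectionOnto ((y : H) + z) = z
      rw [map_add, Submodule.orthogonalProjectionOnto_mem_subspace_eq_self,
        Submodule.orthogonalProjectionOnto_eq_zero_iff.2 (M.le_orthogonal_orthogonal y.2), zero_add]

omit [M.HasOrthogonalProjection] in
theorem spectralSubspace_restrict_le (hM : ∀ x ∈ M, T x ∈ M) (a b : ℝ) :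
    spectralSubspace (T.restrict hM) a b ≤ (spectralSubspace T a b).comap M.subtype := by
  refine Submodule.topologicalClosure_minimal _ (sSup_le ?_)
    ((Submodule.isClosed_topologicalClosure _).preimage continuous_subtype_val)
  rintro N ⟨h1, h2⟩
  rw [← Submodule.map_le_iff_le_comap]
  refine le_spectralSubspace ?_ ?_
  · rintro _ ⟨x, hx, rfl⟩
    exact ⟨_, h1 x hx, rfl⟩
  · rintro _ ⟨x, hx, rfl⟩
    exact h2 x hx

omit [M.HasOrthogonalProjection] in
theorem finiteDimensional_spectralSubspace_restrict (hM : ∀ x ∈ M, T x ∈ M) {a b : ℝ}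
    (h : FiniteDimensional ℝ (spectralSubspace T a b)) :
    FiniteDimensional ℝ (spectralSubspace (T.restrict hM) a b) :=
  FiniteDimensional.of_injective
    (M.subtype.restrict (q := spectralSubspace T a b) (spectralSubspace_restrict_le hM a b))
    fun _ _ h => Subtype.ext (Subtype.ext (congrArg Subtype.val h :))

theorem finrank_spectralSubspace_eq_add (hT : (T : H →ₗ[ℝ] H).IsSymmetric)
    (hM : ∀ x ∈ M, T x ∈ M) (hM' : ∀ x ∈ Mᗮ, T x ∈ Mᗮ) {a b : ℝ}
    (h : FiniteDimensional ℝ (spectralSubspace T a b)) :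
    Module.finrank ℝ (spectralSubspace T a b) =
      Module.finrank ℝ (spectralSubspace (T.restrict hM) a b) +
        Module.finrank ℝ (spectralSubspace (T.restrict hM') a b) := by
  have h1 := finiteDimensional_spectralSubspace_restrict hM h
  have h2 := finiteDimensional_spectralSubspace_restrict hM' h
  have e1 := spectralSubspace_eq_eigenSpan (isSymmetric_restrict hT hM) h1
  have e2 := spectralSubspace_eq_eigenSpan (isSymmetric_restrict hT hM') h2
  rw [e1] at h1
  rw [e2] at h2
  rw [spectralSubspace_eq_eigenSpan hT h, e1, e2, finrank_eigenSpan_eq_add hT hM hM']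

/-- Projecting E(T) onto M lands in E(T|_M), and the residual is orthogonal to E(T|_M) because that
space sits inside E(T). Norm continuity of the spectral projections thus passes to restrictions. -/
theorem spectralProjection_restrict [CompleteSpace H] [CompleteSpace M]
    (hT : (T : H →ₗ[ℝ] H).IsSymmetric) (hM : ∀ x ∈ M, T x ∈ M) {a b : ℝ}
    (h : FiniteDimensional ℝ (spectralSubspace T a b)) :
    spectralProjection (T.restrict hM) a b =
      M.orthogonalProjectionOnto ∘L spectralProjection T a b ∘L M.subtypeL := by
  have h1 := finiteDimensional_spectralSubspace_restrict hM h
  have e := spectralSubspace_eq_eigenSpan hT h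
  have e1 := spectralSubspace_eq_eigenSpan (isSymmetric_restrict hT hM) h1
  rw [spectralProjection_eq rfl, spectralProjection_eq rfl]
  ext1 x
  refine Submodule.eq_starProjection_of_mem_orthogonal ?_ ?_
  · rw [e1]
    exact orthogonalProjectionOnto_mem_eigenSpan hT hM
      (e.le (Submodule.starProjection_apply_mem _ (x : H)))
  · intro y hy
    have hyE : (y : H) ∈ spectralSubspace T a b := spectralSubspace_restrict_le hM a b hy
    have h3 := Submodule.sub_starProjection_mem_orthogonal (K := spectralSubspace T a b)
      (x : H) _ hyE
    rw [inner_sub_right] at h3 ⊢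
    have h4 : inner ℝ y (M.orthogonalProjectionOnto
        ((spectralSubspace T a b).starProjection (x : H))) =
        inner ℝ (y : H) ((spectralSubspace T a b).starProjection (x : H)) :=
      M.inner_orthogonalProjectionOnto_eq_of_mem_left y _
    exact (congrArg (fun t => inner ℝ y x - t) h4).trans h3

open scoped LinearMap.FiniteRangeSetoid in
-- Compressing a quasi-inverse of T to M gives a quasi-inverse of the restriction: the errors are
-- compressions of finite rank operators. On the right this uses that T commutes with the projection
-- onto M.
theorem isFredholm_restrict [CompleteSpace H] [CompleteSpace M]
    (hT : (T : H →ₗ[ℝ] H).IsSymmetric) (hM : ∀ x ∈ M, T x ∈ M)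
    (hF : T.IsFredholm) : (T.restrict hM).IsFredholm := by
  obtain ⟨v, hv1, hv2⟩ := hF.exists_isQuasiInverse
  have hid : (M.orthogonalProjectionOnto : H →ₗ[ℝ] M) ∘ₗ LinearMap.id ∘ₗ M.subtype =
      LinearMap.id := by
    ext1 x
    exact Submodule.orthogonalProjectionOnto_mem_subspace_eq_self x
  refine .of_isQuasiInverse (v := M.orthogonalProjectionOnto ∘L v ∘L M.subtypeL) ⟨?_, ?_⟩
  · have h := LinearMap.FiniteRangeSetoid.equiv_comp_left
      (u' := (M.orthogonalProjectionOnto : H →ₗ[ℝ] M))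
      (LinearMap.FiniteRangeSetoid.equiv_comp_right (u := M.subtype) hv1)
    rw [hid] at h
    exact h
  · have h := LinearMap.FiniteRangeSetoid.equiv_comp_left
      (u' := (M.orthogonalProjectionOnto : H →ₗ[ℝ] M))
      (LinearMap.FiniteRangeSetoid.equiv_comp_right (u := M.subtype) hv2)
    rw [hid] at h
    have h2 : (T.restrict hM : M →ₗ[ℝ] M) ∘ₗ
        ((M.orthogonalProjectionOnto ∘L v ∘L M.subtypeL : M →L[ℝ] M) : M →ₗ[ℝ] M) =
        (M.orthogonalProjectionOnto : H →ₗ[ℝ] M) ∘ₗ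
          ((T : H →ₗ[ℝ] H) ∘ₗ (v : H →ₗ[ℝ] H)) ∘ₗ M.subtype := by
      ext1 x
      exact (orthogonalProjectionOnto_apply_comm hT hM (v x)).symm
    rw [LinearMap.IsRightQuasiInverse, h2]
    exact h

end Restrict

/-! ### Restricted paths and additivity of the flow -/

section RestrictPath

variable {H : Type*} [NormedAddCommGroup H] [InnerProductSpace ℝ H] [CompleteSpace H]
  {L : unitInterval → H →L[ℝ] H} {M : Submodule ℝ H} [CompleteSpace M]

theorem IsFSPath.restrictPath (hL : IsFSPath L) (hM : ∀ t, ∀ x ∈ M, L t x ∈ M) :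
    IsFSPath (restrictPath L M hM) := by
  refine ⟨?_, fun t => ⟨?_, isFredholm_restrict (hL.2 t).1.isSymmetric (hM t) (hL.2 t).2⟩⟩
  · have : _root_.restrictPath L M hM =
        fun t => M.orthogonalProjectionOnto ∘L L t ∘L M.subtypeL := by
      ext t x
      exact (Submodule.starProjection_eq_self_iff.2 (hM t x x.2)).symm
    rw [this]
    exact continuous_const.clm_comp (hL.1.clm_comp continuous_const)
  · exact ContinuousLinearMap.isSelfAdjoint_iff_isSymmetric.2
      (isSymmetric_restrict (hL.2 t).1.isSymmetric (hM t))

/-- An admissible partition for `L` is admissible for the restrictions of `L`. -/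
def SpectralPartition.restrict (p : SpectralPartition L) (hL : ∀ t, IsSelfAdjoint (L t))
    (hM : ∀ t, ∀ x ∈ M, L t x ∈ M) : SpectralPartition (restrictPath L M hM) where
  N := p.N
  node := p.node
  node_strictMono := p.node_strictMono
  node_zero := p.node_zero
  node_last := p.node_last
  a := p.a
  a_pos := p.a_pos
  finiteRank i t ht := finiteDimensional_spectralSubspace_restrict (hM t) (p.finiteRank i t ht)
  continuousOn i := by
    have : ContinuousOn (fun t => M.orthogonalProjectionOnto ∘L
        spectralProjection (L t) (-p.a i) (p.a i) ∘L M.subtypeL)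
        (Set.Icc (p.node i.castSucc) (p.node i.succ)) :=
      continuousOn_const.clm_comp ((p.continuousOn i).clm_comp continuousOn_const)
    exact this.congr fun t ht =>
      spectralProjection_restrict (hL t).isSymmetric (hM t) (p.finiteRank i t ht)

theorem SpectralPartition.flow_eq_add (p : SpectralPartition L) (hL : ∀ t, IsSelfAdjoint (L t))
    (hM : ∀ t, ∀ x ∈ M, L t x ∈ M) (hM' : ∀ t, ∀ x ∈ Mᗮ, L t x ∈ Mᗮ) :
    p.flow = (p.restrict hL hM).flow + (p.restrict hL hM').flow := by
  unfold SpectralPartition.flow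
  refine Eq.trans ?_ (Finset.sum_add_distrib (s := (Finset.univ : Finset (Fin p.N))))
  refine Finset.sum_congr rfl fun i _ => ?_
  have h1 := finrank_spectralSubspace_eq_add (hL _).isSymmetric (hM _) (hM' _) (p.finite_succ i)
  have h2 := finrank_spectralSubspace_eq_add (hL _).isSymmetric (hM _) (hM' _)
    (p.finite_castSucc i)
  rw [h1, h2, Nat.cast_add, Nat.cast_add]
  exact add_sub_add_comm _ _ _ _

end RestrictPath

/-! ### Representations of ℤ₂ and bijectivity of φ -/

section RO

variable {G : Type v} [Group G]

theorem RO.phi_toRO (X : RealRep.{u} G) : RO.phi X.toRO = X.dims :=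
  (AddSubmonoid.LocalizationMap.lift_eq _ _ _ : _)

theorem exists_of_sub_of {M : Type*} [AddCommMonoid M]
    (x : Algebra.GrothendieckAddGroup M) : ∃ a b : M,
      x = Algebra.GrothendieckAddGroup.of a - Algebra.GrothendieckAddGroup.of b := by
  induction x using AddLocalization.ind with
  | H y =>
    refine ⟨y.1, y.2, ?_⟩
    change AddLocalization.mk _ _ = AddLocalization.mk _ 0 - AddLocalization.mk _ 0
    rw [Algebra.GrothendieckAddGroup.mk_sub_mk]
    exact congrArg₂ AddLocalization.mk (add_zero _).symm (Subtype.ext (zero_add _).symm)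

theorem RO.exists_eq_sub (x : RO.{u} G) : ∃ X Y : RealRep.{u} G, x = X.toRO - Y.toRO := by
  obtain ⟨⟨X⟩, ⟨Y⟩, h⟩ := exists_of_sub_of x
  exact ⟨X, Y, h⟩

/-- The generator of `ℤ₂`. -/
abbrev cyc : Multiplicative (ZMod 2) := Multiplicative.ofAdd 1

theorem eq_one_or_eq_cyc (g : Multiplicative (ZMod 2)) : g = 1 ∨ g = cyc := by
  revert g; decide

variable (X Y : RealRep.{u} (Multiplicative (ZMod 2)))

theorem eq_zero_of_eq_neg {V : Type*} [AddCommGroup V] [Module ℝ V] {x : V} (h : x = -x) :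
    x = 0 := by
  have h2 : (2 : ℝ) • x = 0 := by
    rw [two_smul, add_eq_zero_iff_eq_neg]
    exact h
  exact (smul_eq_zero.1 h2).resolve_left two_ne_zero

theorem RealRep.rep_cyc_rep_cyc (x : X.V) : X.rep cyc (X.rep cyc x) = x := by
  rw [← Module.End.mul_apply, ← map_mul, show cyc * cyc = 1 by decide, map_one]
  rfl

theorem RealRep.mem_invariants_iff {x : X.V} : x ∈ X.rep.invariants ↔ X.rep cyc x = x := by
  refine ⟨fun h => h _, fun h g => ?_⟩
  rcases eq_one_or_eq_cyc g with rfl | rfl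
  · simp
  · exact h

/-- The subspace on which `ℤ₂` acts by the sign. -/
noncomputable def RealRep.anti : Submodule ℝ X.V := LinearMap.ker (X.rep cyc + LinearMap.id)

theorem RealRep.mem_anti_iff {x : X.V} : x ∈ X.anti ↔ X.rep cyc x = -x := by
  rw [RealRep.anti, LinearMap.mem_ker, LinearMap.add_apply, LinearMap.id_apply,
    eq_neg_iff_add_eq_zero]

theorem RealRep.isCompl_invariants_anti : IsCompl X.rep.invariants X.anti := by
  constructor
  · rw [Submodule.disjoint_def]
    intro x hx hx'
    rw [X.mem_invariants_iff] at hx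
    rw [X.mem_anti_iff, hx] at hx'
    exact eq_zero_of_eq_neg hx'
  · rw [codisjoint_iff, eq_top_iff]
    intro x _
    refine Submodule.mem_sup.2 ⟨(2⁻¹ : ℝ) • (x + X.rep cyc x), ?_,
      (2⁻¹ : ℝ) • (x - X.rep cyc x), ?_, ?_⟩
    · rw [X.mem_invariants_iff, map_smul, map_add, X.rep_cyc_rep_cyc, add_comm]
    · rw [X.mem_anti_iff, map_smul, map_sub, X.rep_cyc_rep_cyc, ← smul_neg, neg_sub]
    · rw [← smul_add, add_add_sub_cancel, ← two_smul ℝ x, smul_smul]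
      norm_num

/-- Representations of `ℤ₂` are classified by `dim V` and `dim V^G`. -/
theorem RealRep.equiv_of_dims_eq (h : X.dims = Y.dims) : X ≈ Y := by
  have h1 : Module.finrank ℝ X.V = Module.finrank ℝ Y.V := by
    exact Nat.cast_injective (R := ℤ) (congrArg Prod.fst h)
  have h2 : Module.finrank ℝ X.rep.invariants = Module.finrank ℝ Y.rep.invariants := by
    exact Nat.cast_injective (R := ℤ) (congrArg Prod.snd h)
  have h3 : Module.finrank ℝ X.anti = Module.finrank ℝ Y.anti := by
    have hX := Submodule.finrank_add_eq_of_isCompl X.isCompl_invariants_anti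
    have hY := Submodule.finrank_add_eq_of_isCompl Y.isCompl_invariants_anti
    omega
  -- Any linear isomorphisms of the two summands are equivariant, since the generator acts on them
  -- by 1 and by -1.
  let e₁ := LinearEquiv.ofFinrankEq _ _ h2
  let e₂ := LinearEquiv.ofFinrankEq _ _ h3
  let eX := Submodule.prodEquivOfIsCompl _ _ X.isCompl_invariants_anti
  let eY := Submodule.prodEquivOfIsCompl _ _ Y.isCompl_invariants_anti
  let e : X.V ≃ₗ[ℝ] Y.V := eX.symm ≪≫ₗ (e₁.prodCongr e₂) ≪≫ₗ eY
  refine ⟨.mk e fun g => ?_⟩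
  rcases eq_one_or_eq_cyc g with rfl | rfl
  · ext x; simp
  ext x
  obtain ⟨⟨y, z⟩, rfl⟩ := eX.surjective x
  have hact : X.rep cyc (eX (y, z)) = eX (y, -z) := by
    simp only [eX, Submodule.coe_prodEquivOfIsCompl', map_add]
    rw [X.mem_invariants_iff.1 y.2, X.mem_anti_iff.1 z.2]
    rfl
  have hactY : ∀ y z, Y.rep cyc (eY (y, z)) = eY (y, -z) := fun y z => by
    simp only [eY, Submodule.coe_prodEquivOfIsCompl', map_add]
    rw [Y.mem_invariants_iff.1 y.2, Y.mem_anti_iff.1 z.2]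
    rfl
  have he : ∀ y z, e (eX (y, z)) = eY (e₁ y, e₂ z) := fun y z => by
    simp [e]
  change e (X.rep cyc (eX (y, z))) = Y.rep cyc (e (eX (y, z)))
  rw [hact, he, he, hactY, map_neg]

/-- The one dimensional trivial representation of `ℤ₂`. -/
noncomputable def RealRep.one : RealRep.{u} (Multiplicative (ZMod 2)) where
  V := ULift.{u} ℝ
  rep := Representation.trivial ℝ _ _

/-- The one dimensional sign representation of `ℤ₂`. -/
noncomputable def RealRep.sign : RealRep.{u} (Multiplicative (ZMod 2)) where
  V := ULift.{u} ℝ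
  rep :=
    { toFun := fun g => (if g = 1 then (1 : ℝ) else -1) • LinearMap.id
      map_one' := by simp; rfl
      map_mul' := fun g h => by
        rcases eq_one_or_eq_cyc g with rfl | rfl <;> rcases eq_one_or_eq_cyc h with rfl | rfl
        all_goals
          ext
          simp [show cyc * cyc = 1 by decide] }

theorem RealRep.dims_one : RealRep.one.{u}.dims = (1, 1) := by
  have h1 : Module.finrank ℝ RealRep.one.{u}.V = 1 :=
    (ULift.moduleEquiv (R := ℝ) (M := ℝ)).finrank_eq.trans (Module.finrank_self ℝ)
  have h2 : RealRep.one.{u}.rep.invariants = ⊤ := eq_top_iff.2 fun x _ g => rfl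
  unfold RealRep.dims
  rw [h2, finrank_top, h1]
  rfl

theorem RealRep.dims_sign : RealRep.sign.{u}.dims = (1, 0) := by
  have h1 : Module.finrank ℝ RealRep.sign.{u}.V = 1 :=
    (ULift.moduleEquiv (R := ℝ) (M := ℝ)).finrank_eq.trans (Module.finrank_self ℝ)
  have h2 : RealRep.sign.{u}.rep.invariants = ⊥ := by
    rw [eq_bot_iff]
    intro x hx
    have h : RealRep.sign.rep cyc x = -x := by
      change ((if cyc = 1 then (1 : ℝ) else -1) • LinearMap.id : _ →ₗ[ℝ] _) x = -x
      rw [if_neg (by decide), LinearMap.smul_apply, LinearMap.id_apply, neg_smul, one_smul]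
    rw [RealRep.mem_invariants_iff, h] at hx
    exact (Submodule.mem_bot ℝ).2 (eq_zero_of_eq_neg hx.symm)
  unfold RealRep.dims
  rw [h2, finrank_bot, h1]
  rfl

/-- `φ` identifies `RO(ℤ₂)` with `ℤ ⊕ ℤ`. -/
theorem RO.phi_bijective :
    Function.Bijective (RO.phi : RO.{u} (Multiplicative (ZMod 2)) →+ ℤ × ℤ) := by
  constructor
  · rw [injective_iff_map_eq_zero]
    intro x hx
    obtain ⟨X, Y, rfl⟩ := RO.exists_eq_sub x
    rw [map_sub, RO.phi_toRO, RO.phi_toRO, sub_eq_zero] at hx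
    have : (Quotient.mk _ X : RepClass.{u} (Multiplicative (ZMod 2))) = Quotient.mk _ Y :=
      Quotient.sound (X.equiv_of_dims_eq Y hx)
    rw [RealRep.toRO, RealRep.toRO, this, sub_self]
  · rintro ⟨m, n⟩
    -- The trivial line maps to (1, 1) and the sign line to (1, 0), and (m, n) = n(1, 1) + (m -
    -- n)(1, 0).
    refine ⟨n • RealRep.one.toRO + (m - n) • RealRep.sign.toRO, ?_⟩
    rw [map_add, map_zsmul, map_zsmul, RO.phi_toRO, RO.phi_toRO, RealRep.dims_one,
      RealRep.dims_sign]
    simp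

end RO

/-! ### Equivariant spectral flow and conclusion -/

section Equivariant

variable {G : Type v} [Group G] {H : Type u} [NormedAddCommGroup H] [InnerProductSpace ℝ H]
  [CompleteSpace H]

/-- The fixed vectors of E(T) form E(T) ∩ H^G, which is E(T|_{H^G}); the two are identified inside
H. -/
theorem dims_spectralRep {ρ : G →* (H ≃ₗᵢ[ℝ] H)} {T : H →L[ℝ] H} (hT : IsEquivariant ρ T)
    (hs : (T : H →ₗ[ℝ] H).IsSymmetric) (a b : ℝ)
    (hfin : FiniteDimensional ℝ (spectralSubspace T a b)) :
    (spectralRep ρ T hT a b hfin).dims = ((Module.finrank ℝ (spectralSubspace T a b) : ℤ),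
      (Module.finrank ℝ (spectralSubspace (T.restrict hT.map_fixed) a b) : ℤ)) := by
  refine Prod.ext rfl (congrArg (Nat.cast (R := ℤ)) ?_)
  have hmap : ((spectralRep ρ T hT a b hfin).rep.invariants).map
      (spectralSubspace T a b).subtype =
      (spectralSubspace (T.restrict hT.map_fixed) a b).map (fixedSpace ρ).subtype := by
    rw [spectralSubspace_eq_eigenSpan (isSymmetric_restrict hs hT.map_fixed)
      (finiteDimensional_spectralSubspace_restrict hT.map_fixed hfin),
      map_eigenSpan_restrict hs, ← spectralSubspace_eq_eigenSpan hs hfin]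
    ext x
    constructor
    · rintro ⟨y, hy, rfl⟩
      exact ⟨y.2, fun g => congrArg Subtype.val (hy g)⟩
    · rintro ⟨hx, hx'⟩
      exact ⟨⟨x, hx⟩, fun g => Subtype.ext (hx' g), rfl⟩
  exact (Submodule.finrank_map_subtype_eq _ _).symm.trans
    ((congrArg (fun S : Submodule ℝ H => Module.finrank ℝ S) hmap).trans
      (Submodule.finrank_map_subtype_eq _ _))

theorem SpectralPartition.phi_flowG {ρ : G →* (H ≃ₗᵢ[ℝ] H)} {L : unitInterval → H →L[ℝ] H}
    (p : SpectralPartition L) (hL : ∀ t, IsSelfAdjoint (L t)) (hG : ∀ t, IsEquivariant ρ (L t)) :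
    RO.phi (p.flowG ρ hG) = (p.flow, (p.restrict hL fun t => (hG t).map_fixed).flow) := by
  unfold SpectralPartition.flowG
  simp only [map_sum, map_sub, RO.phi_toRO, dims_spectralRep (hG _) (hL _).isSymmetric]
  refine Prod.ext ?_ ?_
  · rw [Prod.fst_sum]; rfl
  · rw [Prod.snd_sum]; rfl

theorem HasEquivariantSpectralFlow.sflG_eq {ρ : G →* (H ≃ₗᵢ[ℝ] H)}
    {L : unitInterval → H →L[ℝ] H} {hG : ∀ t, IsEquivariant ρ (L t)} {x : RO.{u} G}
    (h : HasEquivariantSpectralFlow ρ L hG x) : sflG ρ L hG = x := by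
  have hex : ∃ x, HasEquivariantSpectralFlow ρ L hG x := ⟨x, h⟩
  obtain ⟨p⟩ := h.1
  rw [sflG, dif_pos hex, ← hex.choose_spec.2 p, h.2 p]

end Equivariant

theorem lemma6p1 {H : Type u} [NormedAddCommGroup H] [InnerProductSpace ℝ H] [CompleteSpace H]
    [TopologicalSpace.SeparableSpace H]
    (ρ : Multiplicative (ZMod 2) →* (H ≃ₗᵢ[ℝ] H))
    (L : unitInterval → H →L[ℝ] H) (hL : IsFSPath L) (hG : ∀ t, IsEquivariant ρ (L t)) :
    let Lfix : unitInterval → fixedSpace ρ →L[ℝ] fixedSpace ρ :=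
      restrictPath L (fixedSpace ρ) (fun t => (hG t).map_fixed)
    let Lperp : unitInterval → (fixedSpace ρ)ᗮ →L[ℝ] (fixedSpace ρ)ᗮ :=
      restrictPath L (fixedSpace ρ)ᗮ (fun t => (hG t).map_fixed_orthogonal (hL.2 t).1)
    -- `φ` identifies `RO(ℤ₂)` with `ℤ ⊕ ℤ`
    Function.Bijective (RO.phi : RO.{u} (Multiplicative (ZMod 2)) →+ ℤ × ℤ) ∧
    -- the restrictions are again paths of selfadjoint Fredholm operators
    IsFSPath Lfix ∧ IsFSPath Lperp ∧
    -- all the spectral flows are well defined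
    HasEquivariantSpectralFlow ρ L hG (sflG ρ L hG) ∧
    HasSpectralFlow L (sfl L) ∧ HasSpectralFlow Lfix (sfl Lfix) ∧
    HasSpectralFlow Lperp (sfl Lperp) ∧
    -- the two formulas
    RO.phi (sflG ρ L hG) = (sfl L, sfl Lfix) ∧
    sfl L = sfl Lfix + sfl Lperp := by
  intro Lfix Lperp
  have hLs : ∀ t, IsSelfAdjoint (L t) := fun t => (hL.2 t).1
  have hfix : IsFSPath Lfix := hL.restrictPath _
  have hperp : IsFSPath Lperp := hL.restrictPath _
  obtain ⟨p⟩ := nonempty_spectralPartition hL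
  let pfix : SpectralPartition Lfix := p.restrict hLs _
  let pperp : SpectralPartition Lperp := p.restrict hLs _
  have h := hasSpectralFlow_flow hL p
  have h₁ := hasSpectralFlow_flow hfix pfix
  have h₂ := hasSpectralFlow_flow hperp pperp
  -- By injectivity of φ it suffices that the two integer flows, of L and of its restriction to H^G,
  -- do not depend on the partition.
  have hequiv : HasEquivariantSpectralFlow ρ L hG (p.flowG ρ hG) := ⟨⟨p⟩, fun q =>
    RO.phi_bijective.1 (by
      rw [q.phi_flowG hLs, p.phi_flowG hLs, q.flow_eq hL p,
        SpectralPartition.flow_eq hfix (q.restrict hLs _) pfix])⟩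
  rw [hequiv.sflG_eq, h.sfl_eq, h₁.sfl_eq, h₂.sfl_eq]
  exact ⟨RO.phi_bijective, hfix, hperp, hequiv, h, h₁, h₂, p.phi_flowG hLs hG,
    p.flow_eq_add hLs _ _⟩
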